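/- Suppose that a regular octagon is tiled by finitely many similar right triangles, that is, the (closed, convex) octagon is the union of finitely many closed nondegenerate right triangles that have pairwise disjoint interiors and are similar to each other (a vertex of one triangle may lie on a side of another). Then the smaller acute angle of these triangles belongs to $\left\{\frac{\pi}{8},\frac{\pi}{4}\right\}$. -/

import Mathlib

open scoped EuclideanGeometry Similar

noncomputable section

/-- The Euclidean plane. -/
abbrev Plane : Type := EuclideanSpace ℝ (Fin 2)

/-- The `k`-th vertex of the regular `n`-gon with center `c` and circumradius `r` whose `0`-th
vertex is seen from the center in the direction `θ`. -/
def regularVertex (n : ℕ) (c : Plane) (r θ : ℝ) (k : Fin n) : Plane :=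
  !₂[c 0 + r * Real.cos (θ + 2 * Real.pi * (k : ℕ) / n),
     c 1 + r * Real.sin (θ + 2 * Real.pi * (k : ℕ) / n)]

/-- `S` is a (closed, filled, convex) regular `n`-gon: the convex hull of `n` points equally spaced
on a circle of positive radius. Its position, size and direction are arbitrary. -/
def IsRegularPolygon (n : ℕ) (S : Set Plane) : Prop :=
  3 ≤ n ∧ ∃ (c : Plane) (r θ : ℝ), 0 < r ∧
    S = convexHull ℝ (Set.range (regularVertex n c r θ))

/-- The family of (nondegenerate) triangles `T` tiles the set `S`: the closed triangles cover
exactly `S`, and no two different triangles of the family have a common interior point. A vertex of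
one triangle may lie on a side of another one. -/
structure IsTiling {ι : Type*} (T : ι → Affine.Triangle ℝ Plane) (S : Set Plane) : Prop where
  iUnion_eq : (⋃ i, (T i).closedInterior) = S
  disjoint_interior : Pairwise fun i j => Disjoint (T i).interior (T j).interior

/-- The angle of the triangle `t` at its vertex number `i`. -/
def triangleAngle (t : Affine.Triangle ℝ Plane) (i : Fin 3) : ℝ :=
  ∠ (t.points (i + 1)) (t.points i) (t.points (i + 2))

/-- `t` is a right triangle: one of its angles is `π / 2`. -/
def IsRightTriangle (t : Affine.Triangle ℝ Plane) : Prop :=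
  ∃ i, triangleAngle t i = Real.pi / 2

/-- Two triangles are similar, for a suitable matching of their vertices. -/
def SimilarTriangles (s t : Affine.Triangle ℝ Plane) : Prop :=
  ∃ σ : Equiv.Perm (Fin 3), s.points ∼ t.points ∘ σ

/-- The smallest angle of a triangle (for a right triangle: the smaller acute angle). -/
def smallestAngle (t : Affine.Triangle ℝ Plane) : ℝ :=
  min (triangleAngle t 0) (min (triangleAngle t 1) (triangleAngle t 2))

end

/-!
The proof combines the angle equation at one corner of the octagon with a conjugate area argument.

*Corner.* A vertex of the octagon is an extreme point, so every tile that contains it has a vertex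
there, and the angles of these tiles add up to `3π / 4` (`exists_corner_angles`). As the angles of
the tiles are `α`, `π / 2 - α` and `π / 2` with `α ≤ π / 4`, this leaves only `α = π / 8`,
`α = π / 4` and some angles `π / (4 * k)` or `3π / (4 * k)` with `k ≥ 3` (`angle_cases`).

*Conjugate area.* Let `K` be a subfield of `ℝ` that contains `√2` and `tan α`, and let `φ : K → ℝ`
be an embedding. Choose an additive `f : ℝ → ℝ` with `f (k * x) = φ k * f x` and `f 1 = 1`
(`exists_semilinear_extension`), and apply it to both coordinates in a frame in which the octagon is
the standard one. Segments whose direction is defined over `K` go to segments, in an additive way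
along each line. So the integral of `y dx` along the image, set to `0` for all other segments,
depends only on the signed sum of the edges of a family of triangles on each line, hence only on the
covering multiplicity (`sum_eq_zero_of_edgeInd`). It takes the same value for the tiles as for the
eight central triangles of the octagon. A right triangle with ratio of legs `τ ∈ K` either has all its
sides defined over `K`, and then its image is a right triangle with ratio of legs `φ τ`, or it has
none and contributes `0`. Therefore the area `2 * φ √2` of the image of the octagon is a nonnegative
multiple of `φ (tan α)` (`not_tiled_of_conjugate`).

*Arithmetic.* For each remaining angle there is an automorphism `ζ ↦ ζ ^ s` of a cyclotomic field
that gives `√2` and `tan α` conjugates of opposite signs (`exists_multiplier`,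
`exists_conjugation`), a contradiction.

Since the map `f` need not be measurable, no limit argument is available: exceptional sets are
finite throughout, in the form of the predicate `Generic`.
-/

open Filter Topology

/-! ### Relations between step functions and between segments -/

/-- The Heaviside step function, with value `0` at `0`. -/
noncomputable def heaviside (t : ℝ) : ℝ := if 0 < t then 1 else 0

lemma sum_jump_eq_zero {κ : Type*} [Fintype κ] (d y : κ → ℝ)
    (H : ∀ᶠ t in cofinite, ∑ k, d k * heaviside (t - y k) = 0) (y₀ : ℝ) :
    ∑ k, (if y k = y₀ then d k else 0) = 0 := by
  have hc : ∀ᶠ t in 𝓝[≠] y₀, ∑ k, d k * heaviside (t - y k) = 0 := nhdsNE_le_cofinite y₀ H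
  have hr : ∀ᶠ t in 𝓝[>] y₀, ∀ k, heaviside (t - y k) = if y k ≤ y₀ then 1 else 0 := by
    rw [eventually_all]
    intro k
    by_cases hk : y k ≤ y₀
    · filter_upwards [self_mem_nhdsWithin] with t ht
      have : y₀ < t := ht
      rw [heaviside, if_pos (by linarith), if_pos hk]
    · push Not at hk
      filter_upwards [nhdsWithin_le_nhds (eventually_lt_nhds hk)] with t ht
      rw [heaviside, if_neg (by linarith), if_neg (by linarith)]
  have hl : ∀ᶠ t in 𝓝[<] y₀, ∀ k, heaviside (t - y k) = if y k < y₀ then 1 else 0 := by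
    rw [eventually_all]
    intro k
    by_cases hk : y k < y₀
    · filter_upwards [nhdsWithin_le_nhds (eventually_gt_nhds hk)] with t ht
      rw [heaviside, if_pos (by linarith), if_pos hk]
    · push Not at hk
      filter_upwards [self_mem_nhdsWithin] with t ht
      have : t < y₀ := ht
      rw [heaviside, if_neg (by linarith), if_neg (by linarith)]
  obtain ⟨t, ht, ht'⟩ := ((hc.filter_mono (nhdsGT_le_nhdsNE y₀)).and hr).exists
  obtain ⟨s, hs, hs'⟩ := ((hc.filter_mono (nhdsLT_le_nhdsNE y₀)).and hl).exists
  have : ∑ k, (if y k = y₀ then d k else 0) =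
      ∑ k, d k * heaviside (t - y k) - ∑ k, d k * heaviside (s - y k) := by
    rw [← Finset.sum_sub_distrib]
    refine Finset.sum_congr rfl fun k _ => ?_
    rw [ht', hs']
    rcases lt_trichotomy (y k) y₀ with h | h | h
    · simp [h, h.le, h.ne]
    · simp [h]
    · simp [h.not_gt, h.not_ge, h.ne']
  rw [this, ht, hs, sub_zero]

/-- A linear relation between step functions that holds off a finite set lifts to arbitrary
functions of the jump points. -/
lemma sum_eq_zero_of_heaviside {κ : Type*} [Fintype κ] (d y : κ → ℝ)
    (H : ∀ᶠ t in cofinite, ∑ k, d k * heaviside (t - y k) = 0) (h : ℝ → ℝ) :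
    ∑ k, d k * h (y k) = 0 := by
  classical
  rw [← Finset.sum_fiberwise_of_maps_to
    (fun k _ => Finset.mem_image_of_mem y (Finset.mem_univ k))]
  refine Finset.sum_eq_zero fun v _ => ?_
  have := sum_jump_eq_zero d y H v
  rw [← Finset.sum_filter] at this
  rw [Finset.sum_congr rfl (g := fun k => d k * h v), ← Finset.sum_mul, this, zero_mul]
  intro k hk
  rw [(Finset.mem_filter.1 hk).2]

/-- The same statement for signed indicators of the intervals from `a k` to `b k`. -/
lemma sum_interval_eq_zero {κ : Type*} [Fintype κ] (d a b : κ → ℝ)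
    (H : ∀ᶠ t in cofinite, ∑ k, d k * (heaviside (t - a k) - heaviside (t - b k)) = 0)
    (h : ℝ → ℝ) : ∑ k, d k * (h (b k) - h (a k)) = 0 := by
  have := sum_eq_zero_of_heaviside (κ := κ ⊕ κ) (Sum.elim (fun k => -d k) d) (Sum.elim b a) ?_ h
  · rw [Fintype.sum_sum_type] at this
    simp only [Sum.elim_inl, Sum.elim_inr, ← Finset.sum_add_distrib] at this
    rw [← neg_zero, ← this, ← Finset.sum_neg_distrib]
    exact Finset.sum_congr rfl fun k _ => by ring
  · filter_upwards [H] with t ht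
    rw [Fintype.sum_sum_type]
    simp only [Sum.elim_inl, Sum.elim_inr, ← Finset.sum_add_distrib]
    rw [← ht]
    exact Finset.sum_congr rfl fun k _ => by ring

/-- The slope of the line `pq`; it is `0` when the line is vertical. -/
noncomputable def lineSlope (p q : ℝ × ℝ) : ℝ := (q.2 - p.2) / (q.1 - p.1)

/-- The height at which the line `pq` meets the axis of ordinates. -/
noncomputable def lineIntercept (p q : ℝ × ℝ) : ℝ := p.2 - lineSlope p q * p.1

/-- The signed indicator of the half-strip above the segment `pq`: positive if the segment runs to
the right, negative if it runs to the left, and `0` if it is vertical. -/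
noncomputable def edgeInd (p q z : ℝ × ℝ) : ℝ :=
  (heaviside (z.1 - p.1) - heaviside (z.1 - q.1)) *
    heaviside (z.2 - (lineSlope p q * z.1 + lineIntercept p q))

/-- A property of points of the plane holds generically if on all but finitely many vertical lines
it holds at all but finitely many points. -/
def Generic (P : ℝ × ℝ → Prop) : Prop := ∀ᶠ x in cofinite, ∀ᶠ y in cofinite, P (x, y)

lemma Generic.mono {P Q : ℝ × ℝ → Prop} (hP : Generic P) (h : ∀ z, P z → Q z) : Generic Q :=
  Filter.Eventually.mono hP fun _ hx => hx.mono fun _ hy => h _ hy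

lemma Generic.and {P Q : ℝ × ℝ → Prop} (hP : Generic P) (hQ : Generic Q) :
    Generic fun z => P z ∧ Q z := by
  filter_upwards [hP, hQ] with x h₁ h₂
  exact h₁.and h₂

lemma generic_forall {κ : Type*} [Finite κ] {P : κ → ℝ × ℝ → Prop} (h : ∀ k, Generic (P k)) :
    Generic fun z => ∀ k, P k z := by
  have : ∀ᶠ x in cofinite, ∀ k, ∀ᶠ y in cofinite, P k (x, y) := eventually_all.2 h
  filter_upwards [this] with x hx
  exact eventually_all.2 hx

/-- If the half-strips above the edges of a finite weighted family of segments cancel, then on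
every line the segments of the family cancel. Hence so do the values of every function of segments
that is additive along each line. -/
lemma sum_eq_zero_of_edgeInd {κ : Type*} [Fintype κ] (c : κ → ℝ) (p q : κ → ℝ × ℝ)
    (H : Generic fun z => ∑ k, c k * edgeInd (p k) (q k) z = 0) (h : ℝ → ℝ → ℝ → ℝ) :
    ∑ k, c k * (h (lineSlope (p k) (q k)) (lineIntercept (p k) (q k)) (q k).1 -
      h (lineSlope (p k) (q k)) (lineIntercept (p k) (q k)) (p k).1) = 0 := by
  classical
  set L : κ → ℝ × ℝ := fun k => (lineSlope (p k) (q k), lineIntercept (p k) (q k)) with hL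
  have key : ∀ l : ℝ × ℝ, ∀ᶠ x in cofinite, ∑ k, (if L k = l then c k else 0) *
      (heaviside (x - (p k).1) - heaviside (x - (q k).1)) = 0 := by
    intro l
    have hsep : ∀ᶠ x in cofinite, ∀ k, (L k).1 * x + (L k).2 = l.1 * x + l.2 → L k = l := by
      rw [eventually_all]
      intro k
      by_cases hk : L k = l
      · simp [hk]
      refine Set.Finite.subset (Set.finite_singleton ((l.2 - (L k).2) / ((L k).1 - l.1))) ?_
      intro x hx
      simp only [Set.mem_compl_iff, Set.mem_ofPred_eq, not_forall] at hx
      obtain ⟨hx, -⟩ := hx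
      have hne : (L k).1 - l.1 ≠ 0 := by
        intro h0
        have h1 : (L k).1 = l.1 := by linarith
        rw [h1] at hx
        exact hk (Prod.ext h1 (by linarith))
      rw [Set.mem_singleton_iff, eq_div_iff hne]
      linarith
    filter_upwards [H, hsep] with x hx hs
    have := sum_jump_eq_zero
      (fun k => c k * (heaviside (x - (p k).1) - heaviside (x - (q k).1)))
      (fun k => (L k).1 * x + (L k).2) (by
        filter_upwards [hx] with y hy
        rw [← hy]
        exact Finset.sum_congr rfl fun k _ => by simp only [edgeInd, hL]; ring) (l.1 * x + l.2)
    refine Eq.trans (Finset.sum_congr rfl fun k _ => ?_) this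
    by_cases hk : L k = l
    · simp [hk]
    · simp [hk, mt (hs k) hk]
  have key' : ∀ l : ℝ × ℝ, ∑ k, (if L k = l then
      c k * (h (L k).1 (L k).2 (q k).1 - h (L k).1 (L k).2 (p k).1) else 0) = 0 := by
    intro l
    refine Eq.trans (Finset.sum_congr rfl fun k _ => ?_)
      (sum_interval_eq_zero _ _ _ (key l) (h l.1 l.2))
    by_cases hk : L k = l
    · simp [hk]
    · simp [hk]
  rw [← Finset.sum_fiberwise_of_maps_to
    (fun k _ => Finset.mem_image_of_mem L (Finset.mem_univ k))]
  refine Finset.sum_eq_zero fun v _ => ?_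
  have := key' v
  rwa [← Finset.sum_filter] at this

/-! ### The indicator of a triangle -/

/-- Twice the signed area of the triangle `pqr`. -/
def det₃ (p q r : ℝ × ℝ) : ℝ := (q.1 - p.1) * (r.2 - p.2) - (q.2 - p.2) * (r.1 - p.1)

lemma det₃_rotate (p q r : ℝ × ℝ) : det₃ q r p = det₃ p q r := by simp only [det₃]; ring

lemma det₃_add (p q r z : ℝ × ℝ) : det₃ q r z + det₃ r p z + det₃ p q z = det₃ p q r := by
  simp only [det₃]; ring

lemma det₃_barycentric_fst (p q r z : ℝ × ℝ) :
    det₃ q r z * (p.1 - z.1) + det₃ r p z * (q.1 - z.1) + det₃ p q z * (r.1 - z.1) = 0 := by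
  simp only [det₃]; ring

/-- The open triangle `pqr`: the points that lie strictly on the same side of the three
cyclically oriented edges. -/
def openTriangle (p q r : ℝ × ℝ) : Set (ℝ × ℝ) :=
  {z | (0 < det₃ q r z ∧ 0 < det₃ r p z ∧ 0 < det₃ p q z) ∨
    (det₃ q r z < 0 ∧ det₃ r p z < 0 ∧ det₃ p q z < 0)}

lemma edgeInd_eq {p q z : ℝ × ℝ} (hp : z.1 ≠ p.1) (hq : z.1 ≠ q.1) :
    edgeInd p q z = if p.1 < z.1 ∧ z.1 < q.1 ∧ 0 < det₃ p q z then 1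
      else if q.1 < z.1 ∧ z.1 < p.1 ∧ det₃ p q z < 0 then -1 else 0 := by
  have hd : q.1 - p.1 ≠ 0 →
      det₃ p q z = (q.1 - p.1) * (z.2 - (lineSlope p q * z.1 + lineIntercept p q)) := by
    intro h
    simp only [det₃, lineIntercept, lineSlope]
    field_simp
    ring
  rcases lt_or_gt_of_ne hp with h1 | h1 <;> rcases lt_or_gt_of_ne hq with h2 | h2
  · simp [edgeInd, heaviside, h1.not_gt, h2.not_gt]
  · have h3 : q.1 - p.1 < 0 := by linarith
    rw [hd h3.ne]
    simp [edgeInd, heaviside, h1, h2, h1.not_gt, mul_neg_iff, h3, h3.not_gt]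
  · have h3 : 0 < q.1 - p.1 := by linarith
    rw [hd h3.ne']
    simp [edgeInd, heaviside, h1, h2, h2.not_gt, h3]
  · simp [edgeInd, heaviside, h1, h2, h1.not_gt, h2.not_gt]

open Classical in
/-- The half-strips above the edges of a triangle add up to its indicator, with the sign of its
orientation. -/
lemma edgeInd_triangle {p q r z : ℝ × ℝ} (hp : z.1 ≠ p.1) (hq : z.1 ≠ q.1) (hr : z.1 ≠ r.1)
    (hA : det₃ q r z ≠ 0) (hB : det₃ r p z ≠ 0) (hC : det₃ p q z ≠ 0) :
    edgeInd p q z + edgeInd q r z + edgeInd r p z =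
      SignType.sign (det₃ p q r) * if z ∈ openTriangle p q r then 1 else 0 := by
  have h0 := det₃_barycentric_fst p q r z
  have hD := det₃_add p q r z
  rw [edgeInd_eq hp hq, edgeInd_eq hq hr, edgeInd_eq hr hp, ← hD]
  simp only [openTriangle, Set.mem_ofPred_eq]
  have e1 : ∀ {u v : ℝ}, u < v → ¬ v < u := fun h => h.not_gt
  rcases lt_or_gt_of_ne hp with h1 | h1 <;> rcases lt_or_gt_of_ne hq with h2 | h2 <;>
  rcases lt_or_gt_of_ne hr with h3 | h3 <;>
  rcases lt_or_gt_of_ne hA with hA | hA <;> rcases lt_or_gt_of_ne hB with hB | hB <;>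
  rcases lt_or_gt_of_ne hC with hC | hC <;>
  simp only [h1, h2, h3, hA, hB, hC, e1 h1, e1 h2, e1 h3, e1 hA, e1 hB, e1 hC, and_true,
    and_false, if_true, if_false, or_false, false_or, mul_zero, mul_one, zero_add,
    add_zero, neg_add_cancel, add_neg_cancel] <;>
  first
  | (rw [sign_pos (by linarith)]; simp; done)
  | (rw [sign_neg (by linarith)]; simp; done)
  | (exfalso; nlinarith [mul_pos_of_neg_of_neg hA (sub_neg.2 h1), hA, hB, h0])
  | (exfalso
     rw [← sub_pos] at h1 h2 h3
     nlinarith [mul_pos (sub_pos.2 hA) h1, mul_pos (sub_pos.2 hB) h2, mul_pos (sub_pos.2 hC) h3])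

/-! ### The conjugate area -/

/-- A field embedding of a subfield of `ℝ` into `ℝ` extends to a semilinear map defined on all
of `ℝ`. -/
lemma exists_semilinear_extension (K : Subfield ℝ) (φ : K →+* ℝ) :
    ∃ f : ℝ →+ ℝ, f 1 = 1 ∧ ∀ (k : K) (x : ℝ), f (k * x) = φ k * f x := by
  obtain ⟨g, hg⟩ := LinearMap.exists_leftInverse_of_injective (Algebra.linearMap K ℝ)
    (LinearMap.ker_eq_bot.2 (algebraMap K ℝ).injective)
  have hg1 : g 1 = 1 := by
    have := LinearMap.congr_fun hg 1
    simpa using this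
  refine ⟨φ.toAddMonoidHom.comp g.toAddMonoidHom, ?_, fun k x => ?_⟩
  · change φ (g 1) = 1
    rw [hg1, map_one]
  · change φ (g (k * x)) = φ k * φ (g x)
    have : (k : ℝ) * x = k • x := rfl
    rw [this, map_smul, smul_eq_mul, map_mul]

section Conjugate

variable {K : Subfield ℝ} {φ : K →+* ℝ} {f : ℝ →+ ℝ}

variable (φ f) in
open Classical in
/-- A primitive of `f y d(f x)` along the line of slope `m` and intercept `b`, where `f` is
`φ`-semilinear; it is replaced by `0` when the slope is not in `K`, since `f` does not map such a
line into a line. -/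
noncomputable def linePrimitive (m b x : ℝ) : ℝ :=
  if h : m ∈ K then φ ⟨m, h⟩ * f x ^ 2 / 2 + f b * f x else 0

variable (φ f) in
/-- The integral of `f y d(f x)` along the segment `pq`. -/
noncomputable def conjIntegral (p q : ℝ × ℝ) : ℝ :=
  linePrimitive φ f (lineSlope p q) (lineIntercept p q) q.1 -
    linePrimitive φ f (lineSlope p q) (lineIntercept p q) p.1

lemma conjIntegral_of_mem (hf : ∀ (k : K) (x : ℝ), f (k * x) = φ k * f x) {p q : ℝ × ℝ}
    (h : lineSlope p q ∈ K) :
    conjIntegral φ f p q = (f q.1 - f p.1) * (f p.2 + f q.2) / 2 := by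
  rw [conjIntegral, linePrimitive, linePrimitive, dif_pos h, dif_pos h]
  by_cases hx : q.1 = p.1
  · rw [hx]; ring
  have hx' : q.1 - p.1 ≠ 0 := sub_ne_zero.2 hx
  have h1 : p.2 = lineSlope p q * p.1 + lineIntercept p q := by rw [lineIntercept]; ring
  have h2 : q.2 = lineSlope p q * q.1 + lineIntercept p q := by
    rw [lineIntercept, lineSlope]; field_simp; ring
  have e1 : f p.2 = φ ⟨_, h⟩ * f p.1 + f (lineIntercept p q) := by
    conv_lhs => rw [h1, map_add]
    rw [hf ⟨_, h⟩]
  have e2 : f q.2 = φ ⟨_, h⟩ * f q.1 + f (lineIntercept p q) := by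
    conv_lhs => rw [h2, map_add]
    rw [hf ⟨_, h⟩]
  rw [e1, e2]; ring

lemma conjIntegral_of_notMem {p q : ℝ × ℝ} (h : lineSlope p q ∉ K) :
    conjIntegral φ f p q = 0 := by
  rw [conjIntegral, linePrimitive, linePrimitive, dif_neg h, dif_neg h, sub_zero]

/-- In a right triangle whose ratio of legs lies in `K`, either every side has its slope in `K`, or
no side has. -/
lemma slope_mem_iff {p q r : ℝ × ℝ} {τ : ℝ} (hτK : τ ∈ K) (hτ : τ ≠ 0) (hpq : p ≠ q)
    (h1 : r.1 = p.1 - τ * (q.2 - p.2)) (h2 : r.2 = p.2 + τ * (q.1 - p.1)) :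
    (lineSlope q r ∈ K ↔ lineSlope p q ∈ K) ∧ (lineSlope r p ∈ K ↔ lineSlope p q ∈ K) := by
  obtain ⟨p1, p2⟩ := p
  obtain ⟨q1, q2⟩ := q
  obtain ⟨r1, r2⟩ := r
  simp only [lineSlope] at *
  obtain ⟨a, rfl⟩ : ∃ a, q1 = p1 + a := ⟨q1 - p1, by ring⟩
  obtain ⟨b, rfl⟩ : ∃ b, q2 = p2 + b := ⟨q2 - p2, by ring⟩
  simp only [add_sub_cancel_left] at *
  subst h1 h2
  have ha : a = 0 → b ≠ 0 := by
    rintro rfl rfl; simp at hpq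
  constructor
  · by_cases h0 : a = 0
    · have hb := ha h0
      subst h0
      have : (p2 + τ * 0 - (p2 + b)) / (p1 - τ * b - (p1 + 0)) = τ⁻¹ := by
        rw [show p2 + τ * 0 - (p2 + b) = -b by ring, show p1 - τ * b - (p1 + 0) = -(τ * b) by ring]
        field_simp
      rw [this]
      simp [hτK, K.zero_mem]
    · obtain ⟨m, rfl⟩ : ∃ m, b = a * m := ⟨b / a, by field_simp⟩
      have e : (p2 + τ * a - (p2 + a * m)) / (p1 - τ * (a * m) - (p1 + a)) =
          (m - τ) / (τ * m + 1) := by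
        rw [show p2 + τ * a - (p2 + a * m) = (-a) * (m - τ) by ring,
          show p1 - τ * (a * m) - (p1 + a) = (-a) * (τ * m + 1) by ring,
          mul_div_mul_left _ _ (neg_ne_zero.2 h0)]
      rw [e, mul_div_cancel_left₀ _ h0]
      constructor
      · intro hn
        by_cases hd : τ * m + 1 = 0
        · have : m = -τ⁻¹ := by field_simp; linarith
          rw [this]
          exact K.neg_mem (K.inv_mem hτK)
        · obtain ⟨n, hn'⟩ : ∃ n, n = (m - τ) / (τ * m + 1) := ⟨_, rfl⟩
          rw [← hn'] at hn
          have e1 : m - τ = n * (τ * m + 1) := by rw [hn', div_mul_cancel₀ _ hd]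
          have hne : 1 - n * τ ≠ 0 := by
            intro h
            have h3 : τ = -n := by linear_combination m * h - e1
            rw [h3] at h
            nlinarith [sq_nonneg n]
          have : m = (τ + n) / (1 - n * τ) := by
            rw [eq_div_iff hne]
            linear_combination e1
          rw [this]
          exact K.div_mem (K.add_mem hτK hn) (K.sub_mem K.one_mem (K.mul_mem hn hτK))
      · intro hm
        exact K.div_mem (K.sub_mem hm hτK) (K.add_mem (K.mul_mem hτK hm) K.one_mem)
  · have e : (p2 - (p2 + τ * a)) / (p1 - (p1 - τ * b)) = -(b / a)⁻¹ := by
      rw [show p2 - (p2 + τ * a) = τ * (-a) by ring, show p1 - (p1 - τ * b) = τ * b by ring,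
        mul_div_mul_left _ _ hτ, inv_div, neg_div]
    rw [e, neg_mem_iff, inv_mem_iff]

/-- The conjugate of a right triangle is a right triangle with conjugate ratio of legs, whence the
sign of its signed area. The integral of `y dx` along a boundary with counterclockwise orientation
is minus the area. -/
lemma conjIntegral_right_triangle (hf : ∀ (k : K) (x : ℝ), f (k * x) = φ k * f x)
    {p q r : ℝ × ℝ} {τ : K} (hτ : τ ≠ 0) (hpq : p ≠ q)
    (h1 : r.1 = p.1 - τ * (q.2 - p.2)) (h2 : r.2 = p.2 + τ * (q.1 - p.1)) :
    ∃ C, 0 ≤ C ∧ conjIntegral φ f p q + conjIntegral φ f q r + conjIntegral φ f r p = -φ τ * C := by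
  obtain ⟨e1, e2⟩ := slope_mem_iff τ.2 (by simpa using hτ) hpq h1 h2
  by_cases h : lineSlope p q ∈ K
  · refine ⟨((f q.1 - f p.1) ^ 2 + (f q.2 - f p.2) ^ 2) / 2, by positivity, ?_⟩
    rw [conjIntegral_of_mem hf h, conjIntegral_of_mem hf (e1.2 h), conjIntegral_of_mem hf (e2.2 h),
      h1, h2, map_sub, map_add, hf, hf, map_sub, map_sub]
    ring
  · refine ⟨0, le_rfl, ?_⟩
    rw [conjIntegral_of_notMem h, conjIntegral_of_notMem (mt e1.1 h),
      conjIntegral_of_notMem (mt e2.1 h)]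
    ring

lemma conjIntegral_of_coe (h1 : f 1 = 1) (hf : ∀ (k : K) (x : ℝ), f (k * x) = φ k * f x)
    (a b c d : K) : conjIntegral φ f ((a, b) : ℝ × ℝ) ((c, d) : ℝ × ℝ) =
      (φ c - φ a) * (φ b + φ d) / 2 := by
  have hk : ∀ k : K, f k = φ k := fun k => by
    have := hf k 1
    rwa [mul_one, h1, mul_one] at this
  rw [conjIntegral_of_mem hf]
  · simp only [hk]
  · exact K.div_mem (K.sub_mem d.2 b.2) (K.sub_mem c.2 a.2)

end Conjugate

/-- The vertices of the regular octagon inscribed in the unit circle, with one of them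
at `(1, 0)`. -/
noncomputable def octVertex : Fin 8 → ℝ × ℝ :=
  ![(1, 0), (√2 / 2, √2 / 2), (0, 1), (-(√2 / 2), √2 / 2), (-1, 0), (-(√2 / 2), -(√2 / 2)),
    (0, -1), (√2 / 2, -(√2 / 2))]

lemma det₃_octVertex (k : Fin 8) : det₃ 0 (octVertex k) (octVertex (k + 1)) = √2 / 2 := by
  have h : √2 * √2 = 2 := by simp
  fin_cases k <;> simp [octVertex, det₃]

lemma sq_conj_sqrt_two {K : Subfield ℝ} {φ : K →+* ℝ} {s : K} (hs : (s : ℝ) = √2) :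
    φ s * φ s = 2 := by
  have : s * s = 2 := by
    refine Subtype.ext ?_
    rw [MulMemClass.coe_mul, hs, Real.mul_self_sqrt (by norm_num)]
    exact (map_ofNat K.subtype 2).symm
  rw [← map_mul, this, map_ofNat]

/-- All the central triangles of the octagon have the same conjugate area. -/
lemma conjIntegral_octVertex {K : Subfield ℝ} {φ : K →+* ℝ} {f : ℝ →+ ℝ} (h1 : f 1 = 1)
    (hf : ∀ (k : K) (x : ℝ), f (k * x) = φ k * f x) {s : K} (hs : (s : ℝ) = √2) (k : Fin 8) :
    conjIntegral φ f 0 (octVertex k) + conjIntegral φ f (octVertex k) (octVertex (k + 1)) +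
      conjIntegral φ f (octVertex (k + 1)) 0 = -φ s / 4 := by
  have hs2 : φ s * φ s = 2 := 
    sq_conj_sqrt_two hs
  set B : Fin 8 → K × K := ![(1, 0), (s / 2, s / 2), (0, 1), (-(s / 2), s / 2), (-1, 0),
    (-(s / 2), -(s / 2)), (0, -1), (s / 2, -(s / 2))] with hB
  have h2 : ((2 : K) : ℝ) = 2 := map_ofNat K.subtype 2
  have h2' : φ 2 = 2 := map_ofNat φ 2
  have hcoe : ∀ k, octVertex k = (((B k).1 : ℝ), ((B k).2 : ℝ)) := by
    intro k
    fin_cases k <;> simp [octVertex, hB, hs, h2]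
  have h0 : (0 : ℝ × ℝ) = (((0 : K) : ℝ), ((0 : K) : ℝ)) := by simp; rfl
  rw [hcoe, hcoe, h0, conjIntegral_of_coe h1 hf, conjIntegral_of_coe h1 hf,
    conjIntegral_of_coe h1 hf]
  fin_cases k <;> simp [hB, h2'] <;> linarith

open Classical in
/-- If right triangles, with ratios of legs in `K`, have generically the same covering multiplicity
as the octagon, no embedding of `K` maps the absolute values of these ratios to numbers whose signs
are all opposite to that of the image of `√2`. -/
theorem not_tiled_of_conjugate {ι : Type*} [Fintype ι] (K : Subfield ℝ) (φ : K →+* ℝ) (s : K)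
    (hs : (s : ℝ) = √2) (p q r : ι → ℝ × ℝ) (hpq : ∀ i, p i ≠ q i) (τ : ι → K)
    (hτ : ∀ i, τ i ≠ 0)
    (h1 : ∀ i, (r i).1 = (p i).1 - τ i * ((q i).2 - (p i).2))
    (h2 : ∀ i, (r i).2 = (p i).2 + τ i * ((q i).1 - (p i).1))
    (hneg : ∀ i, SignType.sign (τ i : ℝ) * φ (τ i) * φ s ≤ 0)
    (H : Generic fun z => ∑ i, (if z ∈ openTriangle (p i) (q i) (r i) then (1 : ℝ) else 0) =
      ∑ k, if z ∈ openTriangle 0 (octVertex k) (octVertex (k + 1)) then (1 : ℝ) else 0)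
    (hgen : ∀ i, Generic fun z => (z.1 ≠ (p i).1 ∧ z.1 ≠ (q i).1 ∧ z.1 ≠ (r i).1) ∧
      det₃ (q i) (r i) z ≠ 0 ∧ det₃ (r i) (p i) z ≠ 0 ∧ det₃ (p i) (q i) z ≠ 0)
    (hgen' : ∀ k, Generic fun z =>
      (z.1 ≠ 0 ∧ z.1 ≠ (octVertex k).1 ∧ z.1 ≠ (octVertex (k + 1)).1) ∧
      det₃ (octVertex k) (octVertex (k + 1)) z ≠ 0 ∧ det₃ (octVertex (k + 1)) 0 z ≠ 0 ∧
        det₃ 0 (octVertex k) z ≠ 0) : False := by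
  obtain ⟨f, hf1, hf⟩ := exists_semilinear_extension K φ
  have hsD : ∀ i, (SignType.sign (det₃ (p i) (q i) (r i)) : ℝ) = SignType.sign (τ i : ℝ) := by
    intro i
    have : det₃ (p i) (q i) (r i) =
        τ i * (((q i).1 - (p i).1) ^ 2 + ((q i).2 - (p i).2) ^ 2) := by
      rw [det₃, h1, h2]; ring
    have hpos : 0 < ((q i).1 - (p i).1) ^ 2 + ((q i).2 - (p i).2) ^ 2 := by
      by_contra hle
      refine hpq i (Prod.ext ?_ ?_) <;> nlinarith [sq_nonneg ((q i).1 - (p i).1),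
        sq_nonneg ((q i).2 - (p i).2)]
    rw [this, sign_mul, sign_pos hpos, mul_one]
  have hsO : ∀ k, (SignType.sign (det₃ 0 (octVertex k) (octVertex (k + 1))) : ℝ) = 1 := by
    intro k
    rw [det₃_octVertex, sign_pos (by positivity)]
    rfl
  have hss : ∀ i, (SignType.sign (τ i : ℝ) : ℝ) * SignType.sign (τ i : ℝ) = 1 := by
    intro i
    have : (τ i : ℝ) ≠ 0 := by simpa using hτ i
    rcases lt_or_gt_of_ne this with h | h
    · simp [sign_neg h]
    · simp [sign_pos h]
  have key := sum_eq_zero_of_edgeInd (κ := (ι ⊕ Fin 8) × Fin 3)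
    (fun x => Sum.elim (fun i => (SignType.sign (τ i : ℝ) : ℝ)) (fun _ => -1) x.1)
    (fun x => Sum.elim (fun i => ![p i, q i, r i] x.2)
      (fun k => ![0, octVertex k, octVertex (k + 1)] x.2) x.1)
    (fun x => Sum.elim (fun i => ![q i, r i, p i] x.2)
      (fun k => ![octVertex k, octVertex (k + 1), 0] x.2) x.1) ?_ (linePrimitive φ f)
  · change ∑ x, _ * conjIntegral φ f _ _ = 0 at key
    simp only [Fintype.sum_prod_type, Fintype.sum_sum_type, Fin.sum_univ_three, Sum.elim_inl,
      Sum.elim_inr, ← mul_add, Matrix.cons_val_zero, Matrix.cons_val_one, Matrix.cons_val] at key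
    simp only [conjIntegral_octVertex hf1 hf hs] at key
    choose C hC hC' using fun i => conjIntegral_right_triangle hf (hτ i) (hpq i) (h1 i) (h2 i)
    simp only [hC'] at key
    simp only [Finset.sum_const, Finset.card_univ, Fintype.card_fin, nsmul_eq_mul] at key
    have hs2 : φ s * φ s = 2 := 
      sq_conj_sqrt_two hs
    have hle : ∑ i, SignType.sign (τ i : ℝ) * φ (τ i) * φ s * C i ≤ 0 :=
      Finset.sum_nonpos fun i _ => mul_nonpos_of_nonpos_of_nonneg (hneg i) (hC i)
    have : ∑ i, SignType.sign (τ i : ℝ) * φ (τ i) * φ s * C i =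
        -φ s * ∑ i, (SignType.sign (τ i : ℝ) : ℝ) * (-φ (τ i) * C i) := by
      rw [Finset.mul_sum]
      exact Finset.sum_congr rfl fun i _ => by ring
    rw [this] at hle
    have hX : ∑ i, (SignType.sign (τ i : ℝ) : ℝ) * (-φ (τ i) * C i) = -2 * φ s := by
      push_cast at key
      linarith
    rw [hX] at hle
    nlinarith
  · refine ((H.and (generic_forall hgen)).and (generic_forall hgen')).mono ?_
    rintro z ⟨⟨hz, hz1⟩, hz2⟩
    simp only [Fintype.sum_prod_type, Fintype.sum_sum_type, Fin.sum_univ_three, Sum.elim_inl,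
      Sum.elim_inr, ← mul_add, Matrix.cons_val_zero, Matrix.cons_val_one, Matrix.cons_val]
    have e1 : ∀ i, edgeInd (p i) (q i) z + edgeInd (q i) (r i) z + edgeInd (r i) (p i) z =
        SignType.sign (τ i : ℝ) * if z ∈ openTriangle (p i) (q i) (r i) then 1 else 0 := by
      intro i
      obtain ⟨⟨a1, a2, a3⟩, a4, a5, a6⟩ := hz1 i
      rw [edgeInd_triangle a1 a2 a3 a4 a5 a6, hsD]
    have e2 : ∀ k, edgeInd 0 (octVertex k) z + edgeInd (octVertex k) (octVertex (k + 1)) z +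
        edgeInd (octVertex (k + 1)) 0 z =
        if z ∈ openTriangle 0 (octVertex k) (octVertex (k + 1)) then 1 else 0 := by
      intro k
      obtain ⟨⟨a1, a2, a3⟩, a4, a5, a6⟩ := hz2 k
      rw [edgeInd_triangle a1 a2 a3 a4 a5 a6, hsO, one_mul]
    simp only [e1, e2, ← mul_assoc, hss, one_mul, ← Finset.mul_sum]
    rw [hz]
    ring

/-! ### Conjugation of cosines -/

open IntermediateField in
/-- For `s` coprime to `n`, some embedding of a real field multiplies by `s` the arguments of all
cosines of multiples of `2π / n`. -/
lemma exists_conjugate_cos {n s : ℕ} (hn : n ≠ 0) (hs : s.Coprime n) :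
    ∃ (K : Subfield ℝ) (φ : K →+* ℝ), ∀ a : ℤ, ∃ c : K,
      (c : ℝ) = Real.cos (a * (2 * Real.pi / n)) ∧
        φ c = Real.cos (a * (s * (2 * Real.pi / n))) := by
  set x : ℝ := 2 * Real.pi / n with hx
  set ζ : ℂ := Complex.exp (2 * Real.pi * Complex.I / n) with hζ
  have hζn : IsPrimitiveRoot ζ n := Complex.isPrimitiveRoot_exp n hn
  have hpow : ∀ m : ℕ, (((Real.cos (m * x) : ℝ) : ℂ)) = (ζ ^ m + (ζ ^ m)⁻¹) / 2 := by
    intro m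
    rw [Complex.ofReal_cos, Complex.cos, hζ, ← Complex.exp_nat_mul, ← Complex.exp_neg, hx]
    push_cast
    congr 2 <;> ring_nf
  have hint : IsIntegral ℚ ζ := (hζn.isIntegral (Nat.pos_of_ne_zero hn)).tower_top
  have hcos : IsIntegral ℚ (Real.cos x) := by
    have h1 : IsIntegral ℚ ((Real.cos x : ℝ) : ℂ) := by
      have h2 : IsIntegral ℚ (ζ⁻¹) := hint.inv
      have h3 : IsIntegral ℚ ((2 : ℂ)⁻¹) := by
        simpa using (isIntegral_algebraMap (R := ℚ) (A := ℂ) (x := 2⁻¹))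
      have := hpow 1
      simp only [Nat.cast_one, one_mul, pow_one] at this
      rw [this, div_eq_mul_inv]
      exact (hint.add h2).mul h3
    exact (isIntegral_algebraMap_iff (A := ℝ) (B := ℂ) Complex.ofReal_injective).1 h1
  -- the automorphism of the cyclotomic field shows that `cos (s * x)` is a conjugate of `cos x`
  have hroot : Polynomial.aeval (Real.cos (s * x)) (minpoly ℚ (Real.cos x)) = 0 := by
    let pb := adjoin.powerBasis hint
    have hgen : (pb.gen : ℂ) = ζ := by
      simp [pb, adjoin.powerBasis_gen]
    have hmin : Polynomial.aeval (ζ ^ s) (minpoly ℚ pb.gen) = 0 := by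
      have e1 : minpoly ℚ pb.gen = minpoly ℚ ζ :=
        (minpoly.algebraMap_eq (algebraMap ℚ⟮ζ⟯ ℂ).injective pb.gen).symm.trans
          (congrArg (minpoly ℚ) hgen)
      rw [e1, ← Polynomial.cyclotomic_eq_minpoly_rat hζn (Nat.pos_of_ne_zero hn),
        Polynomial.cyclotomic_eq_minpoly_rat (hζn.pow_of_coprime s hs) (Nat.pos_of_ne_zero hn)]
      exact minpoly.aeval _ _
    let σ := pb.lift (ζ ^ s) hmin
    have hσ : σ pb.gen = ζ ^ s := pb.lift_gen _ hmin
    have h1 : Polynomial.aeval ((pb.gen + pb.gen⁻¹) / 2) (minpoly ℚ (Real.cos x)) = 0 := by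
      have e : algebraMap ℚ⟮ζ⟯ ℂ ((pb.gen + pb.gen⁻¹) / 2) = ((Real.cos x : ℝ) : ℂ) := by
        have := hpow 1
        simp only [Nat.cast_one, one_mul, pow_one] at this
        rw [this, map_div₀, map_add, map_inv₀, map_ofNat]
        exact congrArg (fun w => (w + w⁻¹) / 2) hgen
      apply (algebraMap ℚ⟮ζ⟯ ℂ).injective
      rw [← Polynomial.aeval_algebraMap_apply, e, map_zero]
      exact (Polynomial.aeval_algebraMap_apply ℂ (Real.cos x) _).trans (by simp)
    have h2 := congrArg σ h1
    rw [map_zero, ← Polynomial.aeval_algHom_apply] at h2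
    have e : σ ((pb.gen + pb.gen⁻¹) / 2) = ((Real.cos (s * x) : ℝ) : ℂ) := by
      rw [hpow, map_div₀, map_add, map_inv₀, hσ, map_ofNat]
    rw [e] at h2
    have h3 := (Polynomial.aeval_algebraMap_apply ℂ (Real.cos (s * x))
      (minpoly ℚ (Real.cos x))).symm.trans h2
    exact Complex.ofReal_injective (by simpa using h3)
  let pb := adjoin.powerBasis hcos
  have hgen : (pb.gen : ℝ) = Real.cos x := by simp [pb, adjoin.powerBasis_gen]
  have hmin : Polynomial.aeval (Real.cos (s * x)) (minpoly ℚ pb.gen) = 0 := by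
    have e1 : minpoly ℚ pb.gen = minpoly ℚ (Real.cos x) :=
      (minpoly.algebraMap_eq (algebraMap ℚ⟮Real.cos x⟯ ℝ).injective pb.gen).symm.trans
        (congrArg (minpoly ℚ) hgen)
    rw [e1]
    exact hroot
  let σ := pb.lift _ hmin
  have hσ : σ pb.gen = Real.cos (s * x) := pb.lift_gen _ hmin
  refine ⟨ℚ⟮Real.cos x⟯.toSubfield, σ.toRingHom, fun a => ?_⟩
  refine ⟨(Polynomial.Chebyshev.T ℚ⟮Real.cos x⟯ a).eval pb.gen, ?_, ?_⟩
  · rw [← Polynomial.Chebyshev.T_real_cos]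
    refine Eq.trans ?_ (congrArg (fun w => (Polynomial.Chebyshev.T ℝ a).eval w) hgen)
    exact (Polynomial.eval_map_apply (f := algebraMap ℚ⟮Real.cos x⟯ ℝ) pb.gen).symm.trans
      (by rw [Polynomial.Chebyshev.map_T]; rfl)
  · rw [← Polynomial.Chebyshev.T_real_cos, ← hσ]
    exact (Polynomial.eval_map_apply (f := σ.toRingHom) pb.gen).symm.trans
      (by rw [Polynomial.Chebyshev.map_T]; rfl)

/-- The bound `2 * k` keeps `u * π / (4 * k)` acute. The residues `5` and `7` modulo `8` are those
of the `u` for which `ζ ↦ ζ ^ u`, with `ζ` a primitive eighth root of unity, maps `√(-2)` to its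
opposite. -/
lemma exists_coprime_lt {k : ℕ} (hk : 3 ≤ k) :
    ∃ u : ℕ, u.Coprime (8 * k) ∧ (u % 8 = 5 ∨ u % 8 = 7) ∧ u < 2 * k := by
  have hodd : ∀ u : ℕ, u % 2 = 1 → u.Coprime k → u.Coprime (8 * k) := by
    intro u hu huk
    have : u.Coprime (2 ^ 3) := Nat.Coprime.pow_right 3 (Nat.coprime_two_right.2
      (Nat.odd_iff.2 hu))
    exact Nat.Coprime.mul_right this huk
  have hadd : ∀ (m e : ℕ), m % 2 = 1 → (m + 2 ^ e).Coprime m := by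
    intro m e hm
    rw [Nat.coprime_self_add_left]
    exact Nat.Coprime.pow_left e (Nat.coprime_two_left.2 (Nat.odd_iff.2 hm))
  have hsub : ∀ (m : ℕ), m % 2 = 1 → 2 ≤ m → (m - 2).Coprime m := by
    intro m hm h2
    obtain ⟨j, rfl⟩ : ∃ j, m = j + 2 := ⟨m - 2, by omega⟩
    rw [Nat.add_sub_cancel, Nat.coprime_self_add_right, Nat.coprime_comm]
    exact Nat.coprime_two_left.2 (Nat.odd_iff.2 (by omega))
  -- a number `m ± 2 ^ e`, with `m` the odd part of `k`, is coprime to `2 * m`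
  have key : ∀ m : ℕ, m % 2 = 1 → 3 ≤ m →
      ∃ u : ℕ, u % 2 = 1 ∧ u.Coprime m ∧ (u % 8 = 5 ∨ u % 8 = 7) ∧ u < 2 * m := by
    intro m hm h3
    have h8 : m % 8 = 1 ∨ m % 8 = 3 ∨ m % 8 = 5 ∨ m % 8 = 7 := by omega
    rcases h8 with h | h | h | h
    · exact ⟨m + 2 ^ 2, by omega, hadd m 2 hm, by omega, by omega⟩
    · exact ⟨m + 2 ^ 1, by omega, hadd m 1 hm, by omega, by omega⟩
    · exact ⟨m + 2 ^ 1, by omega, hadd m 1 hm, by omega, by omega⟩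
    · exact ⟨m - 2, by omega, hsub m hm (by omega), by omega, by omega⟩
  have h4 : k % 2 = 1 ∨ k % 4 = 2 ∨ k % 4 = 0 := by omega
  rcases h4 with h | h | h
  · obtain ⟨u, hu, huk, hu8, hlt⟩ := key k h hk
    exact ⟨u, hodd u hu huk, hu8, hlt⟩
  · obtain ⟨m, rfl⟩ : ∃ m, k = 2 * m := ⟨k / 2, by omega⟩
    obtain ⟨u, hu, huk, hu8, hlt⟩ := key m (by omega) (by omega)
    exact ⟨u, hodd u hu (Nat.Coprime.mul_right (Nat.coprime_two_right.2 (Nat.odd_iff.2 hu)) huk),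
      hu8, by omega⟩
  · refine ⟨2 * k - 1, hodd _ (by omega) ?_, by omega, by omega⟩
    have : (2 * k - 1).Coprime (2 * k) := by
      obtain ⟨j, hj⟩ : ∃ j, 2 * k = j + 1 := ⟨2 * k - 1, by omega⟩
      rw [hj, Nat.add_sub_cancel, Nat.coprime_self_add_right]
      simp
    exact this.coprime_mul_left_right

lemma tan_pos_of_lt {u k : ℕ} (hu : 0 < u) (h : u < 2 * k) :
    0 < Real.tan (u * (Real.pi / (4 * k))) := by
  have hk : (0 : ℝ) < k := by exact_mod_cast (by omega : 0 < k)
  have hu' : (0 : ℝ) < u := by exact_mod_cast hu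
  have h' : (u : ℝ) < 2 * k := by exact_mod_cast h
  have hpi := Real.pi_pos
  refine Real.tan_pos_of_pos_of_lt_pi_div_two (by positivity) ?_
  rw [← mul_div_assoc, div_lt_div_iff₀ (by positivity) (by norm_num)]
  nlinarith

/-- The hypothesis lists the angles `a * π / (4 * k)` that the corners of the octagon allow, besides
`π / 8` and `π / 4`. -/
lemma exists_multiplier {a k : ℕ} (h : a = 1 ∧ 3 ≤ k ∨ a = 3 ∧ 3 ≤ k ∧ ¬ 3 ∣ k) :
    ∃ s : ℕ, s.Coprime (8 * k) ∧ (s % 8 = 5 ∨ s % 8 = 7) ∧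
      0 < Real.tan (s * (a * (Real.pi / (4 * k)))) := by
  rcases h with ⟨rfl, hk⟩ | ⟨rfl, hk, h3⟩
  · obtain ⟨u, hu, hu8, hlt⟩ := exists_coprime_lt hk
    refine ⟨u, hu, hu8, ?_⟩
    have := tan_pos_of_lt (by omega) hlt
    simpa using this
  · obtain ⟨u, hu, hu8, hlt⟩ := exists_coprime_lt hk
    -- divide by `3` modulo `8 * k`; this exchanges the residues `5` and `7` modulo `8`
    obtain ⟨s, j, hsj⟩ : ∃ s j : ℕ, 3 * s = u + 8 * k * j := by
      have : k % 3 = 1 ∨ k % 3 = 2 := by omega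
      have hu3 : u % 3 = 0 ∨ u % 3 = 1 ∨ u % 3 = 2 := by omega
      rcases this with h | h <;> rcases hu3 with h' | h' | h'
      · exact ⟨u / 3, 0, by omega⟩
      · exact ⟨(u + 8 * k) / 3, 1, by omega⟩
      · exact ⟨(u + 16 * k) / 3, 2, by omega⟩
      · exact ⟨u / 3, 0, by omega⟩
      · exact ⟨(u + 16 * k) / 3, 2, by omega⟩
      · exact ⟨(u + 8 * k) / 3, 1, by omega⟩
    have hcop : (3 * s).Coprime (8 * k) := by
      rw [hsj]
      simpa using hu
    refine ⟨s, hcop.coprime_mul_left, ?_, ?_⟩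
    · have : (3 * s) % 8 = u % 8 := by
        rw [hsj, mul_assoc, Nat.add_mul_mod_self_left]
      omega
    · have hk0 : (k : ℝ) ≠ 0 := by exact_mod_cast (by omega : k ≠ 0)
      have e : (s : ℝ) * ((3 : ℕ) * (Real.pi / (4 * k))) =
          u * (Real.pi / (4 * k)) + ((2 * j : ℕ) : ℝ) * Real.pi := by
        have : (3 : ℝ) * s = u + 8 * k * j := by exact_mod_cast hsj
        push_cast
        field_simp
        linear_combination this
      rw [e, Real.tan_add_nat_mul_pi]
      exact tan_pos_of_lt (by omega) hlt

/-- If the tangent of the angle `a * π / (4 * k)` stays positive when the angle is multiplied by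
some `s` as below, then some real embedding gives `√2` and that tangent opposite signs. -/
lemma exists_conjugation {a k s : ℕ} (hk : k ≠ 0) (hs : s.Coprime (8 * k))
    (hs8 : s % 8 = 5 ∨ s % 8 = 7) (htan : 0 < Real.tan (s * (a * (Real.pi / (4 * k))))) :
    ∃ (K : Subfield ℝ) (φ : K →+* ℝ) (r t : K), (r : ℝ) = √2 ∧
      (t : ℝ) = Real.tan (a * (Real.pi / (4 * k))) ∧ φ t * φ r < 0 := by
  obtain ⟨K, φ, hφ⟩ := exists_conjugate_cos (n := 8 * k) (by omega) hs
  have hk0 : (k : ℝ) ≠ 0 := by exact_mod_cast hk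
  obtain ⟨r, hr, hr'⟩ := hφ k
  obtain ⟨c, hc, hc'⟩ := hφ a
  obtain ⟨d, hd, hd'⟩ := hφ (a - 2 * k)
  set x : ℝ := a * (Real.pi / (4 * k)) with hx
  have e1 : (k : ℤ) * (2 * Real.pi / (8 * k : ℕ)) = Real.pi / 4 := by
    push_cast; field_simp; norm_num
  have e2 : (a : ℤ) * (2 * Real.pi / (8 * k : ℕ)) = x := by
    rw [hx]; push_cast; field_simp; ring
  have e3 : ((a - 2 * k : ℤ) : ℝ) * (2 * Real.pi / (8 * k : ℕ)) = x - Real.pi / 2 := by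
    rw [hx]; push_cast; field_simp; ring
  rw [e1, Real.cos_pi_div_four] at hr
  rw [e2] at hc
  rw [e3, Real.cos_sub_pi_div_two] at hd
  rw [mul_left_comm, e1] at hr'
  rw [mul_left_comm, e2] at hc'
  rw [mul_left_comm, e3] at hd'
  have h2 : ((2 : K) : ℝ) = 2 := map_ofNat K.subtype 2
  refine ⟨K, φ, 2 * r, d / c, ?_, ?_, ?_⟩
  · rw [MulMemClass.coe_mul, hr, h2]; ring
  · rw [Real.tan_eq_sin_div_cos, ← hc, ← hd]; rfl
  · rw [map_div₀, map_mul, map_ofNat, hr', hc', hd']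
    rw [Real.tan_eq_sin_div_cos] at htan
    obtain ⟨j, hj⟩ : ∃ j : ℕ, s = 8 * j + s % 8 := ⟨s / 8, by omega⟩
    have hsq : 0 < √(2 : ℝ) := by positivity
    rcases hs8 with h | h
    · rw [h] at hj
      have e4 : (s : ℝ) * (Real.pi / 4) = (Real.pi / 4 + Real.pi) + j * (2 * Real.pi) := by
        rw [hj]; push_cast; ring
      have e5 : (s : ℝ) * (x - Real.pi / 2) =
          s * x - Real.pi / 2 - ((2 * j + 1 : ℕ) : ℝ) * (2 * Real.pi) := by
        have : (s : ℝ) = 8 * j + 5 := by rw [hj]; push_cast; ring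
        push_cast
        linear_combination (-Real.pi / 2) * this
      rw [e4, e5, Real.cos_add_nat_mul_two_pi, Real.cos_add_pi, Real.cos_pi_div_four,
        Real.cos_sub_nat_mul_two_pi, Real.cos_sub_pi_div_two]
      nlinarith
    · rw [h] at hj
      have e4 : (s : ℝ) * (Real.pi / 4) = -(Real.pi / 4) + ((j + 1 : ℕ) : ℝ) * (2 * Real.pi) := by
        rw [hj]; push_cast; ring
      have e5 : (s : ℝ) * (x - Real.pi / 2) =
          s * x + Real.pi / 2 - ((2 * j + 2 : ℕ) : ℝ) * (2 * Real.pi) := by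
        have : (s : ℝ) = 8 * j + 7 := by rw [hj]; push_cast; ring
        push_cast
        linear_combination (-Real.pi / 2) * this
      rw [e4, e5, Real.cos_add_nat_mul_two_pi, Real.cos_neg, Real.cos_pi_div_four,
        Real.cos_sub_nat_mul_two_pi, Real.cos_add_pi_div_two, neg_div]
      nlinarith

/-! ### Triangles in coordinates -/

lemma det₃_barycentric_snd (p q r z : ℝ × ℝ) :
    det₃ q r z * (p.2 - z.2) + det₃ r p z * (q.2 - z.2) + det₃ p q z * (r.2 - z.2) = 0 := by
  simp only [det₃]; ring

lemma openTriangle_rotate (p q r : ℝ × ℝ) : openTriangle q r p = openTriangle p q r := by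
  ext z
  simp only [openTriangle, Set.mem_ofPred_eq]
  tauto

/-- The weights of a point with respect to a triangle, up to the common factor `det₃ p q r`. -/
lemma det₃_combination {p q r z : ℝ × ℝ} {a b c : ℝ} (h : a + b + c = 1)
    (hz : a • p + b • q + c • r = z) :
    det₃ q r z = a * det₃ p q r ∧ det₃ r p z = b * det₃ p q r ∧ det₃ p q z = c * det₃ p q r := by
  obtain rfl : a = 1 - b - c := by linarith
  subst hz
  simp only [det₃, Prod.fst_add, Prod.snd_add, Prod.smul_fst, Prod.smul_snd, smul_eq_mul]
  refine ⟨?_, ?_, ?_⟩ <;> ring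

/-- The converse: the determinants, divided by their sum, are the barycentric coordinates. -/
lemma combination_det₃ {p q r : ℝ × ℝ} (hD : det₃ p q r ≠ 0) (z : ℝ × ℝ) :
    (det₃ q r z / det₃ p q r) • p + (det₃ r p z / det₃ p q r) • q +
      (det₃ p q z / det₃ p q r) • r = z := by
  have h1 := det₃_barycentric_fst p q r z
  have h2 := det₃_barycentric_snd p q r z
  have h3 := det₃_add p q r z
  refine Prod.ext ?_ ?_
  · simp only [Prod.fst_add, Prod.smul_fst, smul_eq_mul]
    field_simp
    linear_combination h1 + z.1 * h3
  · simp only [Prod.snd_add, Prod.smul_snd, smul_eq_mul]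
    field_simp
    linear_combination h2 + z.2 * h3

lemma weights_pos {p q r z : ℝ × ℝ} (hz : z ∈ openTriangle p q r) :
    0 < det₃ q r z / det₃ p q r ∧ 0 < det₃ r p z / det₃ p q r ∧ 0 < det₃ p q z / det₃ p q r := by
  have h3 := det₃_add p q r z
  rcases hz with ⟨h, h', h''⟩ | ⟨h, h', h''⟩
  · have : 0 < det₃ p q r := by linarith
    exact ⟨div_pos h this, div_pos h' this, div_pos h'' this⟩
  · have : det₃ p q r < 0 := by linarith
    exact ⟨div_pos_of_neg_of_neg h this, div_pos_of_neg_of_neg h' this,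
      div_pos_of_neg_of_neg h'' this⟩

lemma det₃_ne_zero_of_mem {p q r z : ℝ × ℝ} (hz : z ∈ openTriangle p q r) : det₃ p q r ≠ 0 := by
  have h3 := det₃_add p q r z
  rcases hz with ⟨h, h', h''⟩ | ⟨h, h', h''⟩
  · exact (by linarith : 0 < det₃ p q r).ne'
  · exact (by linarith : det₃ p q r < 0).ne

lemma openTriangle_subset {p q r : ℝ × ℝ} {s : Set (ℝ × ℝ)} (hs : Convex ℝ s) (hp : p ∈ s)
    (hq : q ∈ s) (hr : r ∈ s) : openTriangle p q r ⊆ s := by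
  intro z hz
  obtain ⟨h1, h2, h3⟩ := weights_pos hz
  have hD := det₃_ne_zero_of_mem hz
  rw [← combination_det₃ hD z]
  have hsum : det₃ q r z / det₃ p q r + det₃ r p z / det₃ p q r + det₃ p q z / det₃ p q r = 1 := by
    rw [← add_div, ← add_div, det₃_add, div_self hD]
  have := hs.sum_mem (t := Finset.univ)
    (w := ![det₃ q r z / det₃ p q r, det₃ r p z / det₃ p q r, det₃ p q z / det₃ p q r])
    (z := ![p, q, r]) ?_ ?_ ?_
  · simpa [Fin.sum_univ_three] using this
  · intro i _; fin_cases i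
    exacts [h1.le, h2.le, h3.le]
  · simpa [Fin.sum_univ_three] using hsum
  · intro i _; fin_cases i
    exacts [hp, hq, hr]

section Simplex

variable (t : Affine.Triangle ℝ (ℝ × ℝ))

lemma det₃_points_ne_zero : det₃ (t.points 0) (t.points 1) (t.points 2) ≠ 0 := by
  intro h0
  have hne : t.points 0 ≠ t.points 1 := fun h => by simpa using t.independent.injective h
  have hpts : t.points = ![t.points 0, t.points 1, t.points 2] := by
    ext i : 1
    fin_cases i <;> rfl
  have hind := t.independent
  rw [hpts, affineIndependent_iff_not_collinear_set] at hind
  apply hind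
  generalize t.points 0 = p at *
  generalize t.points 1 = q at *
  generalize t.points 2 = r at *
  rw [collinear_iff_of_mem (p₀ := p) (by simp)]
  have hpos : (q.1 - p.1) ^ 2 + (q.2 - p.2) ^ 2 ≠ 0 := by
    intro h
    refine hne (Prod.ext ?_ ?_) <;> nlinarith [sq_nonneg (q.1 - p.1), sq_nonneg (q.2 - p.2)]
  simp only [det₃] at h0
  refine ⟨q - p, ?_⟩
  simp only [Set.mem_insert_iff, Set.mem_singleton_iff, forall_eq_or_imp, forall_eq]
  refine ⟨⟨0, by simp⟩, ⟨1, by simp⟩, ⟨((r.1 - p.1) * (q.1 - p.1) + (r.2 - p.2) * (q.2 - p.2)) /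
    ((q.1 - p.1) ^ 2 + (q.2 - p.2) ^ 2), ?_⟩⟩
  refine Prod.ext ?_ ?_
  · simp only [vadd_eq_add, Prod.fst_add, Prod.smul_fst, smul_eq_mul, Prod.fst_sub]
    field_simp
    linear_combination (-(q.2 - p.2)) * h0
  · simp only [vadd_eq_add, Prod.snd_add, Prod.smul_snd, smul_eq_mul, Prod.snd_sub]
    field_simp
    linear_combination (q.1 - p.1) * h0

lemma exists_weights {I : Set ℝ} {z : ℝ × ℝ} (hz : z ∈ t.setInterior I) :
    ∃ a b c : ℝ, a ∈ I ∧ b ∈ I ∧ c ∈ I ∧ a + b + c = 1 ∧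
      a • t.points 0 + b • t.points 1 + c • t.points 2 = z := by
  obtain ⟨w, hw1, hw, rfl⟩ := hz
  refine ⟨w 0, w 1, w 2, hw 0, hw 1, hw 2, ?_, ?_⟩
  · rw [← hw1, Fin.sum_univ_three]
  · rw [Finset.univ.affineCombination_eq_linear_combination _ _ hw1, Fin.sum_univ_three]

lemma interior_eq_openTriangle :
    t.interior = openTriangle (t.points 0) (t.points 1) (t.points 2) := by
  ext z
  have hD := det₃_points_ne_zero t
  constructor
  · intro hz
    obtain ⟨a, b, c, ha, hb, hc, hsum, hz⟩ := exists_weights t hz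
    obtain ⟨e1, e2, e3⟩ := det₃_combination hsum hz
    simp only [openTriangle, Set.mem_ofPred_eq, e1, e2, e3]
    rcases lt_or_gt_of_ne hD with h | h
    · exact Or.inr ⟨mul_neg_of_pos_of_neg ha.1 h, mul_neg_of_pos_of_neg hb.1 h,
        mul_neg_of_pos_of_neg hc.1 h⟩
    · exact Or.inl ⟨mul_pos ha.1 h, mul_pos hb.1 h, mul_pos hc.1 h⟩
  · intro hz
    obtain ⟨h1, h2, h3⟩ := weights_pos hz
    have hsum := det₃_add (t.points 0) (t.points 1) (t.points 2) z
    rw [← div_left_inj' hD, add_div, add_div, div_self hD] at hsum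
    have hz' := combination_det₃ hD z
    generalize det₃ (t.points 1) (t.points 2) z / _ = a at *
    generalize det₃ (t.points 2) (t.points 0) z / _ = b at *
    generalize det₃ (t.points 0) (t.points 1) z / _ = c at *
    have hw : ∑ i, ![a, b, c] i = 1 := by simpa [Fin.sum_univ_three] using hsum
    have := (Affine.Simplex.affineCombination_mem_interior_iff (s := t) hw).2 (by
      intro i
      fin_cases i
      · exact ⟨h1, by simp; linarith⟩
      · exact ⟨h2, by simp; linarith⟩
      · exact ⟨h3, by simp; linarith⟩)
    rw [Finset.univ.affineCombination_eq_linear_combination _ _ hw, Fin.sum_univ_three] at this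
    rw [← hz']
    simpa using this

lemma mem_openTriangle_of_mem_closedInterior {z : ℝ × ℝ} (hz : z ∈ t.closedInterior)
    (h1 : det₃ (t.points 1) (t.points 2) z ≠ 0) (h2 : det₃ (t.points 2) (t.points 0) z ≠ 0)
    (h3 : det₃ (t.points 0) (t.points 1) z ≠ 0) :
    z ∈ openTriangle (t.points 0) (t.points 1) (t.points 2) := by
  have hD := det₃_points_ne_zero t
  obtain ⟨a, b, c, ha, hb, hc, hsum, hz⟩ := exists_weights t hz
  obtain ⟨e1, e2, e3⟩ := det₃_combination hsum hz
  rw [e1] at h1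
  rw [e2] at h2
  rw [e3] at h3
  have ha' := ha.1.lt_of_ne' (left_ne_zero_of_mul h1)
  have hb' := hb.1.lt_of_ne' (left_ne_zero_of_mul h2)
  have hc' := hc.1.lt_of_ne' (left_ne_zero_of_mul h3)
  simp only [openTriangle, Set.mem_ofPred_eq, e1, e2, e3]
  rcases lt_or_gt_of_ne hD with h | h
  · exact Or.inr ⟨mul_neg_of_pos_of_neg ha' h, mul_neg_of_pos_of_neg hb' h,
      mul_neg_of_pos_of_neg hc' h⟩
  · exact Or.inl ⟨mul_pos ha' h, mul_pos hb' h, mul_pos hc' h⟩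

end Simplex

/-- The point `z` lies on none of the lines that contain the sides of the triangle `pqr`. -/
def OffLines (p q r z : ℝ × ℝ) : Prop :=
  det₃ q r z ≠ 0 ∧ det₃ r p z ≠ 0 ∧ det₃ p q z ≠ 0

lemma offLines_rotate {p q r z : ℝ × ℝ} : OffLines q r p z ↔ OffLines p q r z := by
  simp only [OffLines]; tauto

open Classical in
/-- Off the lines of the sides, every point of a tiled set lies in exactly one open tile. -/
lemma sum_tiles_eq {ι : Type*} [Fintype ι] {t : ι → Affine.Triangle ℝ (ℝ × ℝ)} {S : Set (ℝ × ℝ)}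
    (hcov : (⋃ i, (t i).closedInterior) = S)
    (hdis : Pairwise fun i j => Disjoint (t i).interior (t j).interior) {z : ℝ × ℝ}
    (hz : ∀ i, OffLines ((t i).points 0) ((t i).points 1) ((t i).points 2) z) :
    ∑ i, (if z ∈ openTriangle ((t i).points 0) ((t i).points 1) ((t i).points 2)
      then (1 : ℝ) else 0) = if z ∈ S then 1 else 0 := by
  by_cases hS : z ∈ S
  · rw [if_pos hS]
    rw [← hcov, Set.mem_iUnion] at hS
    obtain ⟨i, hi⟩ := hS
    obtain ⟨h1, h2, h3⟩ := hz i
    have hi' := mem_openTriangle_of_mem_closedInterior (t i) hi h1 h2 h3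
    rw [Finset.sum_eq_single i, if_pos hi']
    · intro j _ hj
      rw [if_neg]
      intro hj'
      rw [← interior_eq_openTriangle] at hi' hj'
      exact Set.disjoint_left.1 (hdis hj) hj' hi'
    · simp
  · rw [if_neg hS]
    refine Finset.sum_eq_zero fun i _ => if_neg fun hi => hS ?_
    rw [← hcov, Set.mem_iUnion]
    rw [← interior_eq_openTriangle] at hi
    exact ⟨i, (t i).interior_subset_closedInterior hi⟩

lemma generic_det₃_ne_zero {p q : ℝ × ℝ} (h : p ≠ q) : Generic fun z => det₃ p q z ≠ 0 := by
  by_cases hx : q.1 = p.1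
  · have hy : q.2 - p.2 ≠ 0 := fun hy => h (Prod.ext hx.symm (by linarith))
    have : ∀ᶠ x in cofinite, x ≠ p.1 := (Set.finite_singleton p.1).eventually_cofinite_notMem
    refine this.mono fun x hx' => Eventually.of_forall fun y => ?_
    simp only [det₃, hx, sub_self, zero_mul, zero_sub, neg_ne_zero]
    exact mul_ne_zero hy (sub_ne_zero.2 hx')
  · have hx' : q.1 - p.1 ≠ 0 := sub_ne_zero.2 hx
    refine Eventually.of_forall fun x => ?_
    refine ((Set.finite_singleton (p.2 + (q.2 - p.2) * (x - p.1) / (q.1 - p.1))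
      ).eventually_cofinite_notMem).mono fun y hy h0 => hy ?_
    simp only [det₃] at h0
    rw [Set.mem_singleton_iff]
    field_simp
    linear_combination h0

lemma generic_fst_ne (a : ℝ) : Generic fun z => z.1 ≠ a := by
  have : ∀ᶠ x in cofinite, x ≠ a := (Set.finite_singleton a).eventually_cofinite_notMem
  exact this.mono fun x hx => Eventually.of_forall fun y => hx

lemma generic_offLines {p q r : ℝ × ℝ} (hD : det₃ p q r ≠ 0) : Generic (OffLines p q r) := by
  have h1 : p ≠ q := by rintro rfl; simp [det₃] at hD
  have h2 : q ≠ r := by rintro rfl; exact hD (by rw [det₃]; ring)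
  have h3 : r ≠ p := by rintro rfl; simp [det₃] at hD
  exact (generic_det₃_ne_zero h2).and ((generic_det₃_ne_zero h3).and (generic_det₃_ne_zero h1))

/-! ### The standard octagon -/

/-- The octagon with vertices `octVertex k`. -/
def octagon : Set (ℝ × ℝ) := convexHull ℝ (Set.range octVertex)

lemma sqrt_two_bounds : (1.4 : ℝ) < √2 ∧ √2 < 1.5 ∧ √2 * √2 = 2 :=
  ⟨by rw [Real.lt_sqrt (by norm_num)]; norm_num, by rw [Real.sqrt_lt' (by norm_num)]; norm_num,
    by simp⟩

lemma octagon_bounds {z : ℝ × ℝ} (hz : z ∈ octagon) :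
    |z.1| + (√2 - 1) * |z.2| ≤ 1 ∧ (√2 - 1) * |z.1| + |z.2| ≤ 1 := by
  obtain ⟨h1, h2, h3⟩ := sqrt_two_bounds
  have hconv : Convex ℝ {z : ℝ × ℝ | |z.1| + (√2 - 1) * |z.2| ≤ 1 ∧
      (√2 - 1) * |z.1| + |z.2| ≤ 1} := by
    rintro ⟨x, y⟩ ⟨hz, hz'⟩ ⟨x', y'⟩ ⟨hw, hw'⟩ a b ha hb hab
    have ex : |a * x + b * x'| ≤ a * |x| + b * |x'| := by
      refine (abs_add_le _ _).trans ?_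
      rw [abs_mul, abs_mul, abs_of_nonneg ha, abs_of_nonneg hb]
    have ey : |a * y + b * y'| ≤ a * |y| + b * |y'| := by
      refine (abs_add_le _ _).trans ?_
      rw [abs_mul, abs_mul, abs_of_nonneg ha, abs_of_nonneg hb]
    simp only at hz hz' hw hw'
    simp only [Set.mem_ofPred_eq, Prod.smul_mk, smul_eq_mul, Prod.mk_add_mk]
    have hs : 0 ≤ √2 - 1 := by linarith
    constructor
    · calc _ ≤ (a * |x| + b * |x'|) + (√2 - 1) * (a * |y| + b * |y'|) := by gcongr
        _ = a * (|x| + (√2 - 1) * |y|) + b * (|x'| + (√2 - 1) * |y'|) := by ring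
        _ ≤ a * 1 + b * 1 := by gcongr
        _ = 1 := by linarith
    · calc _ ≤ (√2 - 1) * (a * |x| + b * |x'|) + (a * |y| + b * |y'|) := by gcongr
        _ = a * ((√2 - 1) * |x| + |y|) + b * ((√2 - 1) * |x'| + |y'|) := by ring
        _ ≤ a * 1 + b * 1 := by gcongr
        _ = 1 := by linarith
  refine convexHull_min ?_ hconv hz
  rintro _ ⟨k, rfl⟩
  have ha : |√2 / 2| = √2 / 2 := abs_of_pos (by positivity)
  have ha' : |(-(√2 / 2))| = √2 / 2 := by rw [abs_neg, ha]
  fin_cases k <;> simp [octVertex, ha, ha'] <;> (try constructor) <;> nlinarith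

lemma octVertex_mem (k : Fin 8) : octVertex k ∈ octagon := subset_convexHull _ _ ⟨k, rfl⟩

lemma zero_mem_octagon : (0 : ℝ × ℝ) ∈ octagon := by
  have := (convex_convexHull ℝ (Set.range octVertex)) (octVertex_mem 0) (octVertex_mem 4)
    (a := 1 / 2) (b := 1 / 2) (by norm_num) (by norm_num) (by norm_num)
  convert! this using 1
  simp [octVertex, Prod.ext_iff]

open Classical in
/-- The central triangles tile the octagon. -/
lemma sum_central_eq {z : ℝ × ℝ} (hz : ∀ k, OffLines 0 (octVertex k) (octVertex (k + 1)) z) :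
    ∑ k, (if z ∈ openTriangle 0 (octVertex k) (octVertex (k + 1)) then (1 : ℝ) else 0) =
      if z ∈ octagon then 1 else 0 := by
  obtain ⟨h1, h2, h3⟩ := sqrt_two_bounds
  by_cases hS : z ∈ octagon
  · rw [if_pos hS]
    have hS' := octagon_bounds hS
    have hmem : ∀ k, z ∈ openTriangle 0 (octVertex k) (octVertex (k + 1)) ↔
        (0 < det₃ 0 (octVertex k) z ∧ 0 < det₃ (octVertex (k + 1)) 0 z) := by
      intro k
      have hk : 0 ≤ det₃ (octVertex k) (octVertex (k + 1)) z := by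
        obtain ⟨b1, b2⟩ := hS'
        have a1 := le_abs_self z.1
        have a2 := neg_abs_le z.1
        have a3 := le_abs_self z.2
        have a4 := neg_abs_le z.2
        fin_cases k <;> simp [octVertex, det₃] <;> nlinarith
      have hk' : 0 < det₃ (octVertex k) (octVertex (k + 1)) z := hk.lt_of_ne' (hz k).1
      simp only [openTriangle, Set.mem_ofPred_eq, hk', true_and, hk'.not_gt, false_and, or_false]
      tauto
    simp only [hmem]
    have hh : 0 < √2 / 2 := by positivity
    have e : ∀ a : ℝ, √2 / 2 * a < 0 ↔ a < 0 := fun a => by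
      constructor <;> intro h <;> nlinarith
    obtain ⟨x, y⟩ := z
    have hy : y ≠ 0 := by simpa [OffLines, octVertex, det₃] using (hz 0).2.2
    have hx : x ≠ 0 := by simpa [OffLines, octVertex, det₃] using (hz 2).2.2
    have hxy : y - x ≠ 0 := by
      intro h
      obtain rfl : y = x := by linarith
      exact (hz 1).2.2 (by simp [octVertex, det₃])
    have hxy' : x + y ≠ 0 := by
      intro h
      obtain rfl : y = -x := by linarith
      exact (hz 3).2.2 (by simp [octVertex, det₃])
    have d0 : det₃ 0 (octVertex 0) (x, y) = y := by simp [octVertex, det₃]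
    have d1 : det₃ 0 (octVertex 1) (x, y) = √2 / 2 * (y - x) := by simp [octVertex, det₃]; ring
    have d2 : det₃ 0 (octVertex 2) (x, y) = -x := by simp [octVertex, det₃]
    have d3 : det₃ 0 (octVertex 3) (x, y) = -(√2 / 2 * (x + y)) := by simp [octVertex, det₃]; ring
    have d4 : det₃ 0 (octVertex 4) (x, y) = -y := by simp [octVertex, det₃]
    have d5 : det₃ 0 (octVertex 5) (x, y) = -(√2 / 2 * (y - x)) := by simp [octVertex, det₃]; ring
    have d6 : det₃ 0 (octVertex 6) (x, y) = x := by simp [octVertex, det₃]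
    have d7 : det₃ 0 (octVertex 7) (x, y) = √2 / 2 * (x + y) := by simp [octVertex, det₃]; ring
    have hneg : ∀ k, det₃ (octVertex k) 0 (x, y) = -det₃ 0 (octVertex k) (x, y) := fun k => by
      simp [det₃]; ring
    have hlast : (7 : Fin 8) + 1 = 0 := rfl
    simp only [Fin.sum_univ_eight, hneg, zero_add, Fin.reduceAdd, hlast, d0, d1, d2, d3, d4, d5, d6,
      d7, mul_pos_iff_of_pos_left hh, neg_pos, neg_lt_zero, e]
    rcases lt_or_gt_of_ne hy with hy | hy <;> rcases lt_or_gt_of_ne hx with hx | hx <;>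
    rcases lt_or_gt_of_ne hxy with hxy | hxy <;> rcases lt_or_gt_of_ne hxy' with hxy' | hxy' <;>
    first
    | (exfalso; linarith)
    | simp only [hy, hx, hxy, hxy', hy.not_gt, hx.not_gt, hxy.not_gt, hxy'.not_gt, and_true,
        and_false, if_true, if_false, add_zero, zero_add]
  · rw [if_neg hS]
    refine Finset.sum_eq_zero fun k _ => if_neg fun hk => hS ?_
    exact openTriangle_subset (convex_convexHull ℝ _) zero_mem_octagon (octVertex_mem _)
      (octVertex_mem _) hk

/-! ### The corner of the octagon -/

/-- A point near the vertex `(1, 0)`, on the ray of slope `-τ` that points to the left. -/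
def cornerPoint (τ ε : ℝ) : ℝ × ℝ := (1 - ε, ε * τ)

lemma eventually_small {a : ℝ} (ha : 0 < a) : ∀ᶠ ε : ℝ in 𝓝[>] 0, 0 < ε ∧ ε < a := by
  filter_upwards [self_mem_nhdsWithin, nhdsWithin_le_nhds (eventually_lt_nhds ha)] with ε h h'
  exact ⟨h, h'⟩

/-- The direction of almost every ray avoids a given line near the vertex. -/
lemma eventually_det₃_cornerPoint_ne_zero {p q : ℝ × ℝ} (h : p ≠ q) :
    ∀ᶠ τ in cofinite, ∀ᶠ ε in 𝓝[>] 0, det₃ p q (cornerPoint τ ε) ≠ 0 := by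
  have hform : ∀ τ ε, det₃ p q (cornerPoint τ ε) =
      det₃ p q (1, 0) + ε * ((q.1 - p.1) * τ + (q.2 - p.2)) := by
    intro τ ε; simp only [det₃, cornerPoint]; ring
  have hslope : ∀ᶠ τ in cofinite, (q.1 - p.1) * τ + (q.2 - p.2) ≠ 0 := by
    by_cases hx : q.1 - p.1 = 0
    · refine Eventually.of_forall fun τ => ?_
      rw [hx, zero_mul, zero_add]
      exact fun hy => h (Prod.ext (by linarith) (by linarith))
    · refine ((Set.finite_singleton (-(q.2 - p.2) / (q.1 - p.1))).eventually_cofinite_notMem).mono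
        fun τ hτ h0 => hτ ?_
      rw [Set.mem_singleton_iff, eq_div_iff hx]
      linarith
  refine hslope.mono fun τ hτ => ?_
  by_cases h0 : det₃ p q (1, 0) = 0
  · filter_upwards [eventually_small one_pos] with ε hε
    rw [hform, h0, zero_add]
    exact mul_ne_zero hε.1.ne' hτ
  · have hc : Continuous fun ε : ℝ =>
        det₃ p q (1, 0) + ε * ((q.1 - p.1) * τ + (q.2 - p.2)) := by fun_prop
    have := (hc.tendsto 0).eventually_ne (by simpa using h0 : _ ≠ (0 : ℝ))
    filter_upwards [nhdsWithin_le_nhds this] with ε hε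
    rwa [hform]

lemma eventually_offLines_cornerPoint {p q r : ℝ × ℝ} (hD : det₃ p q r ≠ 0) :
    ∀ᶠ τ in cofinite, ∀ᶠ ε in 𝓝[>] 0, OffLines p q r (cornerPoint τ ε) := by
  have h1 : p ≠ q := by rintro rfl; simp [det₃] at hD
  have h2 : q ≠ r := by rintro rfl; exact hD (by rw [det₃]; ring)
  have h3 : r ≠ p := by rintro rfl; simp [det₃] at hD
  filter_upwards [eventually_det₃_cornerPoint_ne_zero h1, eventually_det₃_cornerPoint_ne_zero h2,
    eventually_det₃_cornerPoint_ne_zero h3] with τ a b c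
  filter_upwards [a, b, c] with ε a b c
  exact ⟨b, c, a⟩

/-- Near the corner, the octagon is the sector of half-angle `arctan (1 + √2) = 3π / 8`. -/
lemma eventually_mem_octagon : ∀ᶠ τ in cofinite, ∀ᶠ ε in 𝓝[>] 0,
    (cornerPoint τ ε ∈ octagon ↔ -(1 + √2) < τ ∧ τ < 1 + √2) := by
  obtain ⟨h1, h2, h3⟩ := sqrt_two_bounds
  have hne : ∀ᶠ τ in cofinite, τ ∉ ({1 + √2, -(1 + √2)} : Set ℝ) :=
    (Set.toFinite _).eventually_cofinite_notMem
  filter_upwards [hne] with τ hτ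
  filter_upwards [eventually_small (a := 1 - √2 / 2) (by linarith)] with ε ⟨hε, hε'⟩
  simp only [Set.mem_insert_iff, Set.mem_singleton_iff, not_or] at hτ
  constructor
  · intro hz
    have hb := (octagon_bounds hz).1
    simp only [cornerPoint] at hb
    rw [abs_of_pos (by linarith : 0 < 1 - ε), abs_mul, abs_of_pos hε] at hb
    have hb' : (√2 - 1) * |τ| ≤ 1 := by
      by_contra hcon
      push Not at hcon
      nlinarith
    have hb'' : |τ| ≤ 1 + √2 := by nlinarith
    rw [abs_le] at hb''
    exact ⟨hb''.1.lt_of_ne' hτ.2, hb''.2.lt_of_ne hτ.1⟩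
  · rintro ⟨hl, hr⟩
    refine openTriangle_subset (convex_convexHull ℝ _) (octVertex_mem 7) (octVertex_mem 0)
      (octVertex_mem 1) (Or.inl ⟨?_, ?_, ?_⟩)
    · have : det₃ (octVertex 0) (octVertex 1) (cornerPoint τ ε) =
          ε * (√2 / 2 - (1 - √2 / 2) * τ) := by
        simp [det₃, octVertex, cornerPoint]; ring
      rw [this]
      refine mul_pos hε ?_
      nlinarith
    · have : det₃ (octVertex 1) (octVertex 7) (cornerPoint τ ε) = √2 * (1 - √2 / 2 - ε) := by
        simp [det₃, octVertex, cornerPoint]; ring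
      rw [this]
      exact mul_pos (by linarith) (by linarith)
    · have : det₃ (octVertex 7) (octVertex 0) (cornerPoint τ ε) =
          ε * (√2 / 2 + (1 - √2 / 2) * τ) := by
        simp [det₃, octVertex, cornerPoint]; ring
      rw [this]
      refine mul_pos hε ?_
      nlinarith

lemma eq_or_fst_lt_of_mem_octagon {p : ℝ × ℝ} (hp : p ∈ octagon) : p = (1, 0) ∨ p.1 < 1 := by
  obtain ⟨h1, h2, h3⟩ := sqrt_two_bounds
  have hb := (octagon_bounds hp).1
  have h4 := le_abs_self p.1
  have h5 := abs_nonneg p.2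
  by_cases h : p.1 < 1
  · exact Or.inr h
  · left
    have h6 : |p.2| = 0 := by nlinarith
    have h7 : p.1 = 1 := by nlinarith
    exact Prod.ext h7 (abs_eq_zero.1 h6)

/-- A tile that does not have the corner as a vertex stays away from it. -/
lemma eventually_notMem_of_fst_lt {p q r : ℝ × ℝ} (hp : p.1 < 1) (hq : q.1 < 1) (hr : r.1 < 1)
    (τ : ℝ) : ∀ᶠ ε in 𝓝[>] 0, cornerPoint τ ε ∉ openTriangle p q r := by
  filter_upwards [eventually_small (sub_pos.2 hp), eventually_small (sub_pos.2 hq),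
    eventually_small (sub_pos.2 hr)] with ε h1 h2 h3 hz
  have key := det₃_barycentric_fst p q r (cornerPoint τ ε)
  have e : (cornerPoint τ ε).1 = 1 - ε := rfl
  rcases hz with ⟨a, b, c⟩ | ⟨a, b, c⟩
  · have i1 := mul_neg_of_pos_of_neg a (by linarith : p.1 - (cornerPoint τ ε).1 < 0)
    have i2 := mul_neg_of_pos_of_neg b (by linarith : q.1 - (cornerPoint τ ε).1 < 0)
    have i3 := mul_neg_of_pos_of_neg c (by linarith : r.1 - (cornerPoint τ ε).1 < 0)
    linarith
  · have i1 := mul_pos_of_neg_of_neg a (by linarith : p.1 - (cornerPoint τ ε).1 < 0)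
    have i2 := mul_pos_of_neg_of_neg b (by linarith : q.1 - (cornerPoint τ ε).1 < 0)
    have i3 := mul_pos_of_neg_of_neg c (by linarith : r.1 - (cornerPoint τ ε).1 < 0)
    linarith

/-- The slope parameter of the ray from the corner `(1, 0)` to `p`. -/
noncomputable def cornerSlope (p : ℝ × ℝ) : ℝ := p.2 / (1 - p.1)

/-- Near a vertex at the corner, a tile is the sector between its two sides. -/
lemma eventually_mem_of_vertex {q r : ℝ × ℝ} (hq : q.1 < 1) (hr : r.1 < 1) {τ : ℝ}
    (hτq : τ ≠ cornerSlope q) (hτr : τ ≠ cornerSlope r) : ∀ᶠ ε in 𝓝[>] 0,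
    (cornerPoint τ ε ∈ openTriangle (1, 0) q r ↔
      min (cornerSlope q) (cornerSlope r) < τ ∧ τ < max (cornerSlope q) (cornerSlope r)) := by
  filter_upwards [eventually_small (sub_pos.2 hq), eventually_small (sub_pos.2 hr)]
    with ε ⟨hε, h2⟩ ⟨_, h3⟩
  have key := det₃_barycentric_fst (1, 0) q r (cornerPoint τ ε)
  have e : (cornerPoint τ ε).1 = 1 - ε := rfl
  have hq' : 0 < 1 - q.1 := by linarith
  have hr' : 0 < 1 - r.1 := by linarith
  have hC : det₃ (1, 0) q (cornerPoint τ ε) = (1 - q.1) * ε * (cornerSlope q - τ) := by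
    simp only [det₃, cornerPoint, cornerSlope]; field_simp; ring
  have hB : det₃ r (1, 0) (cornerPoint τ ε) = (1 - r.1) * ε * (τ - cornerSlope r) := by
    simp only [det₃, cornerPoint, cornerSlope]; field_simp; ring
  have i2 : q.1 - (cornerPoint τ ε).1 < 0 := by linarith
  have i3 : r.1 - (cornerPoint τ ε).1 < 0 := by linarith
  have i1 : ((1, 0) : ℝ × ℝ).1 - (cornerPoint τ ε).1 = ε := by rw [e]; ring
  rw [i1] at key
  have hqε := mul_pos hq' hε
  have hrε := mul_pos hr' hε
  simp only [openTriangle, Set.mem_ofPred_eq]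
  rw [min_lt_iff, lt_max_iff]
  rcases lt_or_gt_of_ne hτq with a | a <;> rcases lt_or_gt_of_ne hτr with b | b
  · have hC' : 0 < det₃ (1, 0) q (cornerPoint τ ε) := by rw [hC]; exact mul_pos hqε (by linarith)
    have hB' : det₃ r (1, 0) (cornerPoint τ ε) < 0 := by
      rw [hB]; exact mul_neg_of_pos_of_neg hrε (by linarith)
    simp [hC'.not_gt, hB'.not_gt, a.not_gt, b.not_gt]
  · have hC' : 0 < det₃ (1, 0) q (cornerPoint τ ε) := by rw [hC]; exact mul_pos hqε (by linarith)
    have hB' : 0 < det₃ r (1, 0) (cornerPoint τ ε) := by rw [hB]; exact mul_pos hrε (by linarith)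
    have hA' : 0 < det₃ q r (cornerPoint τ ε) := by
      have := mul_neg_of_pos_of_neg hC' i3
      have := mul_neg_of_pos_of_neg hB' i2
      by_contra hcon
      nlinarith
    simp [hA', hB', hC', a, b]
  · have hC' : det₃ (1, 0) q (cornerPoint τ ε) < 0 := by
      rw [hC]; exact mul_neg_of_pos_of_neg hqε (by linarith)
    have hB' : det₃ r (1, 0) (cornerPoint τ ε) < 0 := by
      rw [hB]; exact mul_neg_of_pos_of_neg hrε (by linarith)
    have hA' : det₃ q r (cornerPoint τ ε) < 0 := by
      have := mul_pos_of_neg_of_neg hC' i3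
      have := mul_pos_of_neg_of_neg hB' i2
      by_contra hcon
      nlinarith
    simp [hA', hB', hC', a, b]
  · have hC' : det₃ (1, 0) q (cornerPoint τ ε) < 0 := by
      rw [hC]; exact mul_neg_of_pos_of_neg hqε (by linarith)
    have hB' : 0 < det₃ r (1, 0) (cornerPoint τ ε) := by rw [hB]; exact mul_pos hrε (by linarith)
    simp [hC'.not_gt, hB'.not_gt, a.not_gt, b.not_gt]

lemma arctan_one_add_sqrt_two : Real.arctan (1 + √2) = 3 * Real.pi / 8 := by
  obtain ⟨h1, h2, h3⟩ := sqrt_two_bounds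
  have hpi := Real.pi_pos
  refine Real.arctan_eq_of_tan_eq ?_ ⟨by linarith, by linarith⟩
  have e : Real.pi / 4 = 2 * (Real.pi / 8) := by ring
  have hc : 0 < Real.cos (Real.pi / 8) :=
    Real.cos_pos_of_mem_Ioo ⟨by linarith, by linarith⟩
  have hs : 0 < Real.sin (Real.pi / 8) := Real.sin_pos_of_pos_of_lt_pi (by linarith) (by linarith)
  have hs2 := Real.sin_two_mul (Real.pi / 8)
  have hc2 := Real.cos_two_mul (Real.pi / 8)
  rw [← e, Real.sin_pi_div_four] at hs2
  rw [← e, Real.cos_pi_div_four] at hc2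
  rw [show 3 * Real.pi / 8 = Real.pi / 2 - Real.pi / 8 by ring, Real.tan_eq_sin_div_cos,
    Real.sin_pi_div_two_sub, Real.cos_pi_div_two_sub, div_eq_iff hs.ne']
  have : Real.cos (Real.pi / 8) * (Real.cos (Real.pi / 8) -
      (1 + √2) * Real.sin (Real.pi / 8)) = 0 := by
    nlinarith
  rcases mul_eq_zero.1 this with h | h <;> linarith

/-- The cosine of the angle between two rays, in terms of the slopes. -/
lemma cos_arctan_sub (a b : ℝ) : Real.cos (Real.arctan a - Real.arctan b) =
    (1 + a * b) / (√(1 + a ^ 2) * √(1 + b ^ 2)) := by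
  rw [Real.cos_sub, Real.cos_arctan, Real.cos_arctan, Real.sin_arctan, Real.sin_arctan]
  field_simp

/-- The cosine of the angle at `p` of the triangle `pqr`. -/
noncomputable def cosAngle (p q r : ℝ × ℝ) : ℝ :=
  ((q.1 - p.1) * (r.1 - p.1) + (q.2 - p.2) * (r.2 - p.2)) /
    (√((q.1 - p.1) ^ 2 + (q.2 - p.2) ^ 2) * √((r.1 - p.1) ^ 2 + (r.2 - p.2) ^ 2))

lemma cosAngle_corner {q r : ℝ × ℝ} (hq : q.1 < 1) (hr : r.1 < 1) :
    cosAngle (1, 0) q r =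
      Real.cos (Real.arctan (cornerSlope q) - Real.arctan (cornerSlope r)) := by
  have hq' : 0 < 1 - q.1 := by linarith
  have hr' : 0 < 1 - r.1 := by linarith
  have hs : ∀ p : ℝ × ℝ, 0 < 1 - p.1 →
      √((p.1 - 1) ^ 2 + (p.2 - 0) ^ 2) = (1 - p.1) * √(1 + cornerSlope p ^ 2) := by
    intro p hp
    have e : (p.1 - 1) ^ 2 + (p.2 - 0) ^ 2 = (1 - p.1) ^ 2 * (1 + cornerSlope p ^ 2) := by
      rw [cornerSlope]; field_simp; ring
    rw [e, Real.sqrt_mul (by positivity), Real.sqrt_sq hp.le]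
  rw [cos_arctan_sub, cosAngle, hs q hq', hs r hr']
  have : (q.1 - 1) * (r.1 - 1) + (q.2 - 0) * (r.2 - 0) =
      ((1 - q.1) * (1 - r.1)) * (1 + cornerSlope q * cornerSlope r) := by
    rw [cornerSlope, cornerSlope]; field_simp; ring
  rw [this, mul_mul_mul_comm, mul_div_mul_left _ _ (mul_pos hq' hr').ne']

lemma arctan_max_sub_min {a b x : ℝ} (hx : 0 ≤ x) (hx' : x ≤ Real.pi)
    (h : Real.cos x = Real.cos (Real.arctan a - Real.arctan b)) :
    Real.arctan (max a b) - Real.arctan (min a b) = x := by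
  have e : Real.arctan (max a b) - Real.arctan (min a b) = |Real.arctan a - Real.arctan b| := by
    rcases le_total a b with hab | hab
    · rw [max_eq_right hab, min_eq_left hab, abs_sub_comm,
        abs_of_nonneg (sub_nonneg.2 (Real.arctan_strictMono.monotone hab))]
    · rw [max_eq_left hab, min_eq_right hab,
        abs_of_nonneg (sub_nonneg.2 (Real.arctan_strictMono.monotone hab))]
  rw [e]
  have ha := Real.arctan_mem_Ioo a
  have hb := Real.arctan_mem_Ioo b
  refine Real.injOn_cos ⟨abs_nonneg _, ?_⟩ ⟨hx, hx'⟩ (by rw [Real.cos_abs, h])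
  rw [abs_le]
  exact ⟨by linarith [ha.1, hb.2], by linarith [ha.2, hb.1]⟩

/-- The sector that a tile occupies at the corner `(1, 0)`: it is empty, or its angle is an angle
of the tile. -/
lemma exists_sector (P : Fin 3 → ℝ × ℝ) (hP : ∀ j, P j ∈ octagon)
    (hD : det₃ (P 0) (P 1) (P 2) ≠ 0) (ang : Fin 3 → ℝ) (hang : ∀ j, 0 ≤ ang j)
    (hang' : ∀ j, ang j ≤ Real.pi)
    (hcos : ∀ j, Real.cos (ang j) = cosAngle (P j) (P (j + 1)) (P (j + 2))) :
    ∃ lo hi : ℝ, lo ≤ hi ∧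
      (∀ᶠ τ in cofinite, ∀ᶠ ε in 𝓝[>] 0,
        (cornerPoint τ ε ∈ openTriangle (P 0) (P 1) (P 2) ↔ lo < τ ∧ τ < hi)) ∧
      (Real.arctan hi - Real.arctan lo = 0 ∨ ∃ j, Real.arctan hi - Real.arctan lo = ang j) := by
  have hvertex : ∀ p q r : ℝ × ℝ, p ∈ octagon → q ∈ octagon → r ∈ octagon → det₃ p q r ≠ 0 →
      p = (1, 0) → ∀ x, 0 ≤ x → x ≤ Real.pi → Real.cos x = cosAngle p q r →
      ∃ lo hi : ℝ, lo ≤ hi ∧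
      (∀ᶠ τ in cofinite, ∀ᶠ ε in 𝓝[>] 0,
        (cornerPoint τ ε ∈ openTriangle p q r ↔ lo < τ ∧ τ < hi)) ∧
      Real.arctan hi - Real.arctan lo = x := by
    intro p q r hp hq hr hD hp0 x hx hx' hc
    subst hp0
    have hq1 : q.1 < 1 := (eq_or_fst_lt_of_mem_octagon hq).resolve_left (by
      rintro rfl; simp [det₃] at hD)
    have hr1 : r.1 < 1 := (eq_or_fst_lt_of_mem_octagon hr).resolve_left (by
      rintro rfl; simp [det₃] at hD)
    refine ⟨min (cornerSlope q) (cornerSlope r), max (cornerSlope q) (cornerSlope r),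
      min_le_max, ?_, ?_⟩
    · have hne : ∀ᶠ τ in cofinite, τ ∉ ({cornerSlope q, cornerSlope r} : Set ℝ) :=
        (Set.toFinite _).eventually_cofinite_notMem
      refine hne.mono fun τ hτ => ?_
      simp only [Set.mem_insert_iff, Set.mem_singleton_iff, not_or] at hτ
      exact eventually_mem_of_vertex hq1 hr1 hτ.1 hτ.2
    · refine arctan_max_sub_min hx hx' ?_
      rw [hc, cosAngle_corner hq1 hr1]
  rcases eq_or_fst_lt_of_mem_octagon (hP 0) with h0 | h0
  · obtain ⟨lo, hi, h1, h2, h3⟩ := hvertex _ _ _ (hP 0) (hP 1) (hP 2) hD h0 _ (hang 0) (hang' 0)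
      (hcos 0)
    exact ⟨lo, hi, h1, h2, Or.inr ⟨0, h3⟩⟩
  rcases eq_or_fst_lt_of_mem_octagon (hP 1) with h1 | h1
  · obtain ⟨lo, hi, h1, h2, h3⟩ := hvertex _ _ _ (hP 1) (hP 2) (hP 0)
      (by rwa [det₃_rotate]) h1 _ (hang 1) (hang' 1) (hcos 1)
    rw [openTriangle_rotate] at h2
    exact ⟨lo, hi, h1, h2, Or.inr ⟨1, h3⟩⟩
  rcases eq_or_fst_lt_of_mem_octagon (hP 2) with h2 | h2
  · obtain ⟨lo, hi, h1, h2, h3⟩ := hvertex _ _ _ (hP 2) (hP 0) (hP 1)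
      (by rwa [det₃_rotate, det₃_rotate]) h2 _ (hang 2) (hang' 2) (hcos 2)
    rw [openTriangle_rotate, openTriangle_rotate] at h2
    exact ⟨lo, hi, h1, h2, Or.inr ⟨2, h3⟩⟩
  · refine ⟨0, 0, le_rfl, Eventually.of_forall fun τ => ?_, Or.inl (sub_self _)⟩
    refine (eventually_notMem_of_fst_lt h0 h1 h2 τ).mono fun ε hε => ?_
    exact iff_of_false hε fun h => (h.1.trans h.2).false

/-- The angles of the tiles at a corner of the octagon add up to `3π / 4`. -/
lemma exists_corner_angles {ι : Type*} [Finite ι] {t : ι → Affine.Triangle ℝ (ℝ × ℝ)}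
    (hcov : (⋃ i, (t i).closedInterior) = octagon)
    (hdis : Pairwise fun i j => Disjoint (t i).interior (t j).interior)
    (ang : ι → Fin 3 → ℝ) (hang : ∀ i j, 0 ≤ ang i j) (hang' : ∀ i j, ang i j ≤ Real.pi)
    (hcos : ∀ i j, Real.cos (ang i j) =
      cosAngle ((t i).points j) ((t i).points (j + 1)) ((t i).points (j + 2))) :
    ∃ (s : Finset ι) (j : ι → Fin 3), ∑ i ∈ s, ang i (j i) = 3 * Real.pi / 4 := by
  classical
  have := Fintype.ofFinite ι
  have hP : ∀ i j, (t i).points j ∈ octagon := fun i j => by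
    rw [← hcov, Set.mem_iUnion]
    exact ⟨i, (t i).point_mem_closedInterior j⟩
  choose lo hi hle hmem hval using fun i =>
    exists_sector (t i).points (hP i) (det₃_points_ne_zero _) (ang i) (hang i) (hang' i) (hcos i)
  obtain ⟨h1, h2, h3⟩ := sqrt_two_bounds
  have hoff : ∀ᶠ τ in cofinite, ∀ i, ∀ᶠ ε in 𝓝[>] 0,
      OffLines ((t i).points 0) ((t i).points 1) ((t i).points 2) (cornerPoint τ ε) :=
    eventually_all.2 fun i => eventually_offLines_cornerPoint (det₃_points_ne_zero _)
  have hind : ∀ {a b τ : ℝ}, a ≤ b → τ ≠ a → τ ≠ b →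
      heaviside (τ - a) - heaviside (τ - b) = if a < τ ∧ τ < b then 1 else 0 := by
    intro a b τ hab ha hb
    rcases lt_or_gt_of_ne ha with ha | ha <;> rcases lt_or_gt_of_ne hb with hb | hb
    · simp [heaviside, ha.not_gt, hb.not_gt]
    · linarith
    · simp [heaviside, ha, hb, hb.not_gt]
    · simp [heaviside, ha, hb, hb.not_gt]
  have hne : ∀ᶠ τ in cofinite, ∀ i, τ ≠ lo i ∧ τ ≠ hi i := eventually_all.2 fun i => by
    have : ∀ᶠ τ in cofinite, τ ∉ ({lo i, hi i} : Set ℝ) :=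
      (Set.toFinite _).eventually_cofinite_notMem
    simpa using this
  have hne' : ∀ᶠ τ in cofinite, τ ∉ ({1 + √2, -(1 + √2)} : Set ℝ) :=
    (Set.toFinite _).eventually_cofinite_notMem
  have key := sum_interval_eq_zero (κ := Option ι) (fun o => o.elim (-1) fun _ => 1)
    (fun o => o.elim (-(1 + √2)) lo) (fun o => o.elim (1 + √2) hi) ?_ Real.arctan
  · simp only [Fintype.sum_option, Option.elim_none, Option.elim_some, one_mul, Real.arctan_neg,
      arctan_one_add_sqrt_two] at key
    have hval' : ∀ i, ∃ j, Real.arctan (hi i) - Real.arctan (lo i) = 0 ∨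
        Real.arctan (hi i) - Real.arctan (lo i) = ang i j := by
      intro i
      rcases hval i with h | ⟨j, h⟩
      · exact ⟨0, Or.inl h⟩
      · exact ⟨j, Or.inr h⟩
    choose j hj using hval'
    refine ⟨Finset.univ.filter fun i => Real.arctan (hi i) - Real.arctan (lo i) ≠ 0, j, ?_⟩
    have : ∑ i, (Real.arctan (hi i) - Real.arctan (lo i)) = 3 * Real.pi / 4 := by linarith
    refine Eq.trans (Finset.sum_congr rfl fun i hmem => ?_)
      ((Finset.sum_filter_ne_zero _).trans this)
    exact ((hj i).resolve_left (Finset.mem_filter.1 hmem).2).symm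
  · filter_upwards [eventually_all.2 hmem, hoff, eventually_mem_octagon, hne, hne']
      with τ a b c d e
    obtain ⟨ε, a, b, c⟩ := ((eventually_all.2 a).and ((eventually_all.2 b).and c)).exists
    simp only [Set.mem_insert_iff, Set.mem_singleton_iff, not_or] at e
    have hs := sum_tiles_eq hcov hdis b
    simp only [Fintype.sum_option, Option.elim_none, Option.elim_some, one_mul,
      hind (hle _) (d _).1 (d _).2, hind (by linarith : -(1 + √2) ≤ 1 + √2) e.2 e.1]
    simp only [a, c] at hs
    rw [hs]
    ring

/-! ### Right triangles and the frame of the octagon -/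

lemma triangleAngle_eq_of_similar {s t : Affine.Triangle ℝ Plane} {σ : Equiv.Perm (Fin 3)}
    (h : s.points ∼ t.points ∘ σ) (i : Fin 3) : triangleAngle s i = triangleAngle t (σ i) := by
  have h' := h.index_map ![i + 1, i, i + 2]
  have e1 : s.points ∘ ![i + 1, i, i + 2] = ![s.points (i + 1), s.points i, s.points (i + 2)] := by
    ext j : 1; fin_cases j <;> rfl
  have e2 : (t.points ∘ σ) ∘ ![i + 1, i, i + 2] =
      ![t.points (σ (i + 1)), t.points (σ i), t.points (σ (i + 2))] := by
    ext j : 1; fin_cases j <;> rfl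
  rw [e1, e2] at h'
  rw [triangleAngle, h'.angle_eq, triangleAngle]
  have key : ∀ (σ : Equiv.Perm (Fin 3)) (i : Fin 3), (σ (i + 1) = σ i + 1 ∧ σ (i + 2) = σ i + 2) ∨
      (σ (i + 1) = σ i + 2 ∧ σ (i + 2) = σ i + 1) := by decide
  rcases key σ i with ⟨a, b⟩ | ⟨a, b⟩
  · rw [a, b]
  · rw [a, b, EuclideanGeometry.angle_comm]

lemma smallestAngle_le (t : Affine.Triangle ℝ Plane) (i : Fin 3) :
    smallestAngle t ≤ triangleAngle t i := by
  fin_cases i <;> simp [smallestAngle]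

lemma exists_smallestAngle_eq (t : Affine.Triangle ℝ Plane) :
    ∃ i, smallestAngle t = triangleAngle t i := by
  rw [smallestAngle]
  rcases min_choice (triangleAngle t 0) (min (triangleAngle t 1) (triangleAngle t 2)) with h | h
  · exact ⟨0, h⟩
  · rw [h]
    rcases min_choice (triangleAngle t 1) (triangleAngle t 2) with h | h
    · exact ⟨1, h⟩
    · exact ⟨2, h⟩

lemma smallestAngle_eq_of_similar {s t : Affine.Triangle ℝ Plane} (h : SimilarTriangles s t) :
    smallestAngle s = smallestAngle t := by
  obtain ⟨σ, h⟩ := h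
  refine le_antisymm ?_ ?_
  · obtain ⟨i, hi⟩ := exists_smallestAngle_eq t
    rw [hi, ← σ.apply_symm_apply i, ← triangleAngle_eq_of_similar h]
    exact smallestAngle_le _ _
  · obtain ⟨i, hi⟩ := exists_smallestAngle_eq s
    rw [hi, triangleAngle_eq_of_similar h]
    exact smallestAngle_le _ _

/-- The angles of a right triangle in terms of the smallest one. -/
lemma angles_of_right {t : Affine.Triangle ℝ Plane} {j : Fin 3}
    (hj : triangleAngle t j = Real.pi / 2) :
    0 < smallestAngle t ∧ smallestAngle t ≤ Real.pi / 4 ∧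
      ((triangleAngle t (j + 1) = smallestAngle t ∧
          triangleAngle t (j + 2) = Real.pi / 2 - smallestAngle t) ∨
        (triangleAngle t (j + 1) = Real.pi / 2 - smallestAngle t ∧
          triangleAngle t (j + 2) = smallestAngle t)) := by
  have hinj := t.independent.injective
  have n1 : t.points (j + 1) ≠ t.points j := hinj.ne (by simp)
  have n2 : t.points (j + 2) ≠ t.points j := hinj.ne (by simp)
  have a1 : triangleAngle t (j + 1) = ∠ (t.points (j + 2)) (t.points (j + 1)) (t.points j) := by
    rw [triangleAngle, add_assoc, add_assoc]
    simp
  have a2 : triangleAngle t (j + 2) = ∠ (t.points j) (t.points (j + 2)) (t.points (j + 1)) := by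
    rw [triangleAngle, add_assoc, add_assoc]
    simp
  have hj' := hj
  rw [triangleAngle] at hj'
  have p2 : 0 < triangleAngle t (j + 2) := by
    rw [a2]
    exact EuclideanGeometry.angle_pos_of_angle_eq_pi_div_two hj' (Or.inl n1)
  have p1 : 0 < triangleAngle t (j + 1) := by
    rw [a1, EuclideanGeometry.angle_comm]
    rw [EuclideanGeometry.angle_comm] at hj'
    exact EuclideanGeometry.angle_pos_of_angle_eq_pi_div_two hj' (Or.inl n2)
  have hsum : triangleAngle t (j + 1) + triangleAngle t (j + 2) = Real.pi / 2 := by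
    have := EuclideanGeometry.angle_add_angle_add_angle_eq_pi (t.points (j + 2)) n1.symm
    rw [hj', ← a2, ← a1] at this
    linarith
  have hmin : smallestAngle t = min (triangleAngle t j)
      (min (triangleAngle t (j + 1)) (triangleAngle t (j + 2))) := by
    rw [smallestAngle]
    fin_cases j
    · rfl
    · change _ = min (triangleAngle t 1) (min (triangleAngle t 2) (triangleAngle t 0))
      rw [← min_assoc (triangleAngle t 1), min_comm]
    · change _ = min (triangleAngle t 2) (min (triangleAngle t 0) (triangleAngle t 1))
      rw [← min_assoc (triangleAngle t 0), min_comm]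
  rw [hj] at hmin
  rcases le_total (triangleAngle t (j + 1)) (triangleAngle t (j + 2)) with h | h
  · rw [min_eq_left h, min_eq_right (by linarith)] at hmin
    rw [hmin]
    exact ⟨p1, by linarith, Or.inl ⟨rfl, by linarith⟩⟩
  · rw [min_eq_right h, min_eq_right (by linarith)] at hmin
    rw [hmin]
    exact ⟨p2, by linarith, Or.inr ⟨by linarith, rfl⟩⟩

/-- The coordinates of the plane in which the regular polygon with center `c`, circumradius `r` and
direction `θ` becomes the standard one. -/
noncomputable def frameMap (c : Plane) (r θ : ℝ) : Plane →ᵃ[ℝ] ℝ × ℝ where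
  toFun z := (((z 0 - c 0) * Real.cos θ + (z 1 - c 1) * Real.sin θ) / r,
    ((z 1 - c 1) * Real.cos θ - (z 0 - c 0) * Real.sin θ) / r)
  linear :=
    { toFun := fun v => ((v 0 * Real.cos θ + v 1 * Real.sin θ) / r,
        (v 1 * Real.cos θ - v 0 * Real.sin θ) / r)
      map_add' := fun v w => by
        refine Prod.ext ?_ ?_ <;> simp <;> ring
      map_smul' := fun a v => by
        refine Prod.ext ?_ ?_ <;> simp <;> ring }
  map_vadd' := fun z v => by
    refine Prod.ext ?_ ?_ <;> simp <;> ring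

section Frame

variable {c : Plane} {r θ : ℝ}

/-- The frame map multiplies inner products by `1 / r ^ 2`. -/
lemma frameMap_inner (hr : 0 < r) (p q s : Plane) :
    ((frameMap c r θ q).1 - (frameMap c r θ p).1) * ((frameMap c r θ s).1 - (frameMap c r θ p).1) +
    ((frameMap c r θ q).2 - (frameMap c r θ p).2) * ((frameMap c r θ s).2 - (frameMap c r θ p).2) =
      inner ℝ (q - p) (s - p) / r ^ 2 := by
  simp only [frameMap, AffineMap.coe_mk, PiLp.inner_apply, Fin.sum_univ_two, PiLp.sub_apply,
    RCLike.inner_apply, conj_trivial]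
  field_simp
  linear_combination ((q 0 - p 0) * (s 0 - p 0) + (q 1 - p 1) * (s 1 - p 1)) *
    Real.sin_sq_add_cos_sq θ

lemma frameMap_norm (hr : 0 < r) (p q : Plane) :
    √(((frameMap c r θ q).1 - (frameMap c r θ p).1) ^ 2 +
      ((frameMap c r θ q).2 - (frameMap c r θ p).2) ^ 2) = ‖q - p‖ / r := by
  rw [sq, sq, frameMap_inner hr, real_inner_self_eq_norm_sq, ← div_pow,
    Real.sqrt_sq (by positivity)]

lemma frameMap_injective (hr : 0 < r) : Function.Injective (frameMap c r θ) := by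
  intro p q h
  have := frameMap_norm (c := c) (θ := θ) hr q p
  rw [h] at this
  simp only [sub_self, ne_eq, OfNat.ofNat_ne_zero, not_false_eq_true, zero_pow, add_zero,
    Real.sqrt_zero] at this
  have h0 : ‖p - q‖ = 0 := by
    rcases div_eq_zero_iff.1 this.symm with h | h
    · exact h
    · exact absurd h hr.ne'
  exact sub_eq_zero.1 (norm_eq_zero.1 h0)

lemma cos_angle_eq_cosAngle (hr : 0 < r) (p q s : Plane) : Real.cos (∠ q p s) =
    cosAngle (frameMap c r θ p) (frameMap c r θ q) (frameMap c r θ s) := by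
  rw [EuclideanGeometry.angle, InnerProductGeometry.cos_angle, cosAngle, frameMap_inner hr,
    frameMap_norm hr, frameMap_norm hr]
  simp only [vsub_eq_sub]
  field_simp

lemma frameMap_regularVertex (hr : 0 < r) (k : Fin 8) :
    frameMap c r θ (regularVertex 8 c r θ k) = octVertex k := by
  have h : frameMap c r θ (regularVertex 8 c r θ k) =
      (Real.cos (2 * Real.pi * (k : ℕ) / 8), Real.sin (2 * Real.pi * (k : ℕ) / 8)) := by
    have hc := Real.cos_sub (θ + 2 * Real.pi * (k : ℕ) / 8) θ
    have hs := Real.sin_sub (θ + 2 * Real.pi * (k : ℕ) / 8) θ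
    rw [add_sub_cancel_left] at hc hs
    rw [hc, hs]
    refine Prod.ext ?_ ?_
    · simp [frameMap, regularVertex]
      field_simp
    · simp [frameMap, regularVertex]
      field_simp
  rw [h]
  fin_cases k <;> refine Prod.ext ?_ ?_ <;> simp [octVertex]
  · rw [show 2 * Real.pi / 8 = Real.pi / 4 by ring, Real.cos_pi_div_four]
  · rw [show 2 * Real.pi / 8 = Real.pi / 4 by ring, Real.sin_pi_div_four]
  · rw [show 2 * Real.pi * 2 / 8 = Real.pi / 2 by ring, Real.cos_pi_div_two]
  · rw [show 2 * Real.pi * 2 / 8 = Real.pi / 2 by ring, Real.sin_pi_div_two]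
  · rw [show 2 * Real.pi * 3 / 8 = Real.pi - Real.pi / 4 by ring, Real.cos_pi_sub,
      Real.cos_pi_div_four]
  · rw [show 2 * Real.pi * 3 / 8 = Real.pi - Real.pi / 4 by ring, Real.sin_pi_sub,
      Real.sin_pi_div_four]
  · rw [show 2 * Real.pi * 4 / 8 = Real.pi by ring, Real.cos_pi]
  · rw [show 2 * Real.pi * 4 / 8 = Real.pi by ring, Real.sin_pi]
  · rw [show 2 * Real.pi * 5 / 8 = Real.pi / 4 + Real.pi by ring, Real.cos_add_pi,
      Real.cos_pi_div_four]
  · rw [show 2 * Real.pi * 5 / 8 = Real.pi / 4 + Real.pi by ring, Real.sin_add_pi,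
      Real.sin_pi_div_four]
  · rw [show 2 * Real.pi * 6 / 8 = Real.pi / 2 + Real.pi by ring, Real.cos_add_pi,
      Real.cos_pi_div_two, neg_zero]
  · rw [show 2 * Real.pi * 6 / 8 = Real.pi / 2 + Real.pi by ring, Real.sin_add_pi,
      Real.sin_pi_div_two]
  · rw [show 2 * Real.pi * 7 / 8 = -(Real.pi / 4) + 2 * Real.pi by ring, Real.cos_add_two_pi,
      Real.cos_neg, Real.cos_pi_div_four]
  · rw [show 2 * Real.pi * 7 / 8 = -(Real.pi / 4) + 2 * Real.pi by ring, Real.sin_add_two_pi,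
      Real.sin_neg, Real.sin_pi_div_four]

end Frame

/-- In a triangle with a right angle at `p`, the third vertex is obtained from the leg `pq` by a
rotation through a right angle and a dilation by some ratio `τ`, whose absolute value is the
tangent of the angle at `q`. -/
lemma exists_leg_ratio {p q r : ℝ × ℝ} (hD : det₃ p q r ≠ 0) {x : ℝ} (hx : 0 ≤ x)
    (hx' : x ≤ Real.pi) (hp : cosAngle p q r = 0) (hq : Real.cos x = cosAngle q r p) :
    ∃ τ : ℝ, r.1 = p.1 - τ * (q.2 - p.2) ∧ r.2 = p.2 + τ * (q.1 - p.1) ∧ |τ| = Real.tan x := by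
  set u : ℝ := (q.1 - p.1) ^ 2 + (q.2 - p.2) ^ 2 with hu
  have hu0 : 0 < u := by
    refine lt_of_le_of_ne (by positivity) fun h => hD ?_
    have e1 : q.1 - p.1 = 0 := by nlinarith [sq_nonneg (q.1 - p.1), sq_nonneg (q.2 - p.2)]
    have e2 : q.2 - p.2 = 0 := by nlinarith [sq_nonneg (q.1 - p.1), sq_nonneg (q.2 - p.2)]
    rw [det₃, e1, e2]; ring
  have hw0 : 0 < (r.1 - p.1) ^ 2 + (r.2 - p.2) ^ 2 := by
    refine lt_of_le_of_ne (by positivity) fun h => hD ?_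
    have e1 : r.1 - p.1 = 0 := by nlinarith [sq_nonneg (r.1 - p.1), sq_nonneg (r.2 - p.2)]
    have e2 : r.2 - p.2 = 0 := by nlinarith [sq_nonneg (r.1 - p.1), sq_nonneg (r.2 - p.2)]
    rw [det₃, e1, e2]; ring
  have hdot : (q.1 - p.1) * (r.1 - p.1) + (q.2 - p.2) * (r.2 - p.2) = 0 := by
    rw [cosAngle, div_eq_zero_iff] at hp
    refine hp.resolve_right (mul_ne_zero ?_ ?_)
    · exact (Real.sqrt_pos.2 hu0).ne'
    · exact (Real.sqrt_pos.2 hw0).ne'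
  obtain ⟨τ, hτ⟩ : ∃ τ, τ = det₃ p q r / u := ⟨_, rfl⟩
  have h1 : r.1 = p.1 - τ * (q.2 - p.2) := by
    rw [hτ]
    field_simp
    rw [det₃, hu]
    linear_combination (q.1 - p.1) * hdot
  have h2 : r.2 = p.2 + τ * (q.1 - p.1) := by
    rw [hτ]
    field_simp
    rw [det₃, hu]
    linear_combination (q.2 - p.2) * hdot
  refine ⟨τ, h1, h2, ?_⟩
  have e1 : (r.1 - q.1) * (p.1 - q.1) + (r.2 - q.2) * (p.2 - q.2) = u := by
    rw [h1, h2, hu]; ring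
  have e2 : (r.1 - q.1) ^ 2 + (r.2 - q.2) ^ 2 = u * (1 + τ ^ 2) := by
    rw [h1, h2, hu]; ring
  have e3 : (p.1 - q.1) ^ 2 + (p.2 - q.2) ^ 2 = u := by rw [hu]; ring
  have hcos : Real.cos x = Real.cos (Real.arctan |τ|) := by
    rw [hq, cosAngle, e1, e2, e3, Real.cos_arctan, sq_abs, Real.sqrt_mul hu0.le, mul_right_comm,
      Real.mul_self_sqrt hu0.le, ← div_div, div_self hu0.ne']
  have hpi := Real.pi_pos
  have hmem : Real.arctan |τ| ∈ Set.Icc 0 Real.pi :=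
    ⟨Real.arctan_nonneg.2 (abs_nonneg _), by linarith [Real.arctan_lt_pi_div_two |τ|]⟩
  rw [Real.injOn_cos ⟨hx, hx'⟩ hmem hcos, Real.tan_arctan]

/-! ### The possible angles and the conclusion -/

/-- The possible angles, by the equation that they satisfy at a corner of the octagon. -/
lemma angle_cases {α : ℝ} (h0 : 0 < α) (h1 : α ≤ Real.pi / 4) {p q r : ℕ}
    (h : p * α + q * (Real.pi / 2 - α) + r * (Real.pi / 2) = 3 * Real.pi / 4) :
    α = Real.pi / 8 ∨ α = Real.pi / 4 ∨ ∃ a k : ℕ, (a = 1 ∧ 3 ≤ k ∨ a = 3 ∧ 3 ≤ k ∧ ¬ 3 ∣ k) ∧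
      α = a * (Real.pi / (4 * k)) := by
  have hpi := Real.pi_pos
  obtain ⟨x, rfl⟩ : ∃ x, α = x * (Real.pi / 4) := ⟨α / (Real.pi / 4), by field_simp⟩
  have hx0 : 0 < x := by
    by_contra hcon
    nlinarith
  have hx1 : x ≤ 1 := by
    by_contra hcon
    nlinarith
  have hx : p * x + q * (2 - x) + 2 * r = 3 := by
    have : (p * x + q * (2 - x) + 2 * r) * (Real.pi / 4) = 3 * (Real.pi / 4) := by
      linear_combination h
    exact mul_right_cancel₀ (by positivity) this
  have hp : (0 : ℝ) ≤ p * x := by positivity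
  have hunit : ∀ n : ℕ, n * x = 1 → x * (Real.pi / 4) = Real.pi / 8 ∨
      x * (Real.pi / 4) = Real.pi / 4 ∨ ∃ a k : ℕ,
      (a = 1 ∧ 3 ≤ k ∨ a = 3 ∧ 3 ≤ k ∧ ¬ 3 ∣ k) ∧ x * (Real.pi / 4) = a * (Real.pi / (4 * k)) := by
    intro n hn
    have hn0 : n ≠ 0 := by rintro rfl; simp at hn
    have hn0' : (n : ℝ) ≠ 0 := by exact_mod_cast hn0
    obtain rfl : x = 1 / n := by field_simp; linarith
    by_cases h3 : 3 ≤ n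
    · exact Or.inr (Or.inr ⟨1, n, Or.inl ⟨rfl, h3⟩, by push_cast; field_simp⟩)
    · have : n = 1 ∨ n = 2 := by omega
      rcases this with rfl | rfl
      · right; left; norm_num
      · left; push_cast; ring
  have hr : r < 2 := by
    by_contra hcon
    have : (2 : ℝ) ≤ r := by exact_mod_cast not_lt.1 hcon
    have : (0 : ℝ) ≤ q * (2 - x) := mul_nonneg (by positivity) (by linarith)
    linarith
  have hq : q < 4 := by
    by_contra hcon
    have h4 : (4 : ℝ) ≤ q := by exact_mod_cast not_lt.1 hcon
    have : (0 : ℝ) ≤ r := by positivity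
    nlinarith
  have hone : x = 1 → x * (Real.pi / 4) = Real.pi / 4 := by rintro rfl; ring
  interval_cases r <;> interval_cases q <;> push_cast at hx
  · by_cases h3 : 3 ∣ p
    · obtain ⟨m, rfl⟩ := h3
      refine hunit m ?_
      push_cast at hx
      linarith
    · have hp0 : (p : ℝ) ≠ 0 := by rintro h; rw [h] at hx; linarith
      have hp3 : 3 ≤ p := by
        by_contra hcon
        have : (p : ℝ) ≤ 2 := by exact_mod_cast (by omega : p ≤ 2)
        nlinarith
      refine Or.inr (Or.inr ⟨3, p, Or.inr ⟨rfl, hp3, h3⟩, ?_⟩)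
      have : x = 3 / p := by field_simp; linarith
      rw [this]; push_cast; field_simp
  · obtain ⟨m, rfl⟩ : ∃ m, p = m + 1 := by
      refine ⟨p - 1, ?_⟩
      have : p ≠ 0 := by rintro rfl; push_cast at hx; linarith
      omega
    refine hunit m ?_
    push_cast at hx
    linarith
  · have hp2 : p < 2 := by
      by_contra hcon
      have : (2 : ℝ) ≤ p := by exact_mod_cast not_lt.1 hcon
      nlinarith
    interval_cases p <;> push_cast at hx
    · refine hunit 2 ?_
      push_cast; linarith
    · exact Or.inr (Or.inl (hone (by linarith)))
  · have hp2 : x = 1 := by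
      by_contra hcon
      have : x < 1 := lt_of_le_of_ne hx1 hcon
      nlinarith
    exact Or.inr (Or.inl (hone hp2))
  · exact hunit p (by linarith)
  · exact Or.inr (Or.inl (hone (by linarith)))
  · exfalso; linarith
  · exfalso; linarith

theorem corollary4 {ι : Type*} [Finite ι] (S : Set Plane) (hS : IsRegularPolygon 8 S)
    (T : ι → Affine.Triangle ℝ Plane) (hT : IsTiling T S)
    (hright : ∀ i, IsRightTriangle (T i))
    (hsim : ∀ i j, SimilarTriangles (T i) (T j)) :
    ∃ α ∈ ({Real.pi / 8, Real.pi / 4} : Set ℝ), ∀ i, smallestAngle (T i) = α := by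
  classical
  have := Fintype.ofFinite ι
  obtain ⟨-, c, r, θ, hr, rfl⟩ := hS
  have hinj := frameMap_injective (c := c) (θ := θ) hr
  set t : ι → Affine.Triangle ℝ (ℝ × ℝ) := fun i => (T i).map (frameMap c r θ) hinj with ht
  have hcov : (⋃ i, (t i).closedInterior) = octagon := by
    simp only [ht, Affine.Simplex.closedInterior_map, ← Set.image_iUnion, hT.iUnion_eq]
    rw [AffineMap.image_convexHull, ← Set.range_comp, octagon]
    congr 2
    ext1 k
    exact frameMap_regularVertex hr k
  have hdis : Pairwise fun i j => Disjoint (t i).interior (t j).interior := by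
    intro i j hij
    simp only [ht, Affine.Simplex.interior_map]
    exact (Set.disjoint_image_iff hinj).2 (hT.disjoint_interior hij)
  have hcos : ∀ i j, Real.cos (triangleAngle (T i) j) =
      cosAngle ((t i).points j) ((t i).points (j + 1)) ((t i).points (j + 2)) := fun i j =>
    cos_angle_eq_cosAngle hr _ _ _
  have hnn : ∀ i j, 0 ≤ triangleAngle (T i) j := fun i j => EuclideanGeometry.angle_nonneg _ _ _
  have hle : ∀ i j, triangleAngle (T i) j ≤ Real.pi := fun i j =>
    EuclideanGeometry.angle_le_pi _ _ _
  obtain ⟨i₀, -⟩ : ∃ i, (0 : ℝ × ℝ) ∈ (t i).closedInterior := by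
    have := zero_mem_octagon
    rwa [← hcov, Set.mem_iUnion] at this
  obtain ⟨α, hα⟩ : ∃ α, α = smallestAngle (T i₀) := ⟨_, rfl⟩
  have hαi : ∀ i, smallestAngle (T i) = α := fun i => by
    rw [hα]; exact smallestAngle_eq_of_similar (hsim i i₀)
  choose j hj using hright
  have hang := fun i => angles_of_right (hj i)
  simp only [hαi] at hang
  have hα0 := (hang i₀).1
  have hα1 := (hang i₀).2.1
  have hangle : ∀ i k, ∃ p q r : ℕ, triangleAngle (T i) k =
      p * α + q * (Real.pi / 2 - α) + r * (Real.pi / 2) := by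
    intro i k
    have hk : k = j i ∨ k = j i + 1 ∨ k = j i + 2 := by
      generalize j i = l
      revert k l
      decide
    obtain ⟨-, -, h⟩ := hang i
    have hα' : ∃ p q r : ℕ, α = p * α + q * (Real.pi / 2 - α) + r * (Real.pi / 2) :=
      ⟨1, 0, 0, by simp⟩
    have hβ' : ∃ p q r : ℕ, Real.pi / 2 - α =
        p * α + q * (Real.pi / 2 - α) + r * (Real.pi / 2) := ⟨0, 1, 0, by simp⟩
    rcases hk with rfl | rfl | rfl
    · exact ⟨0, 0, 1, by rw [hj]; simp⟩
    · rcases h with ⟨h, -⟩ | ⟨h, -⟩ <;> rw [h] <;> assumption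
    · rcases h with ⟨-, h⟩ | ⟨-, h⟩ <;> rw [h] <;> assumption
  obtain ⟨s, k, hsum⟩ := exists_corner_angles hcov hdis _ hnn hle hcos
  have hcorner : ∃ p q r : ℕ, ∑ i ∈ s, triangleAngle (T i) (k i) =
      p * α + q * (Real.pi / 2 - α) + r * (Real.pi / 2) := by
    refine Finset.sum_induction _ (fun x => ∃ p q r : ℕ,
      x = p * α + q * (Real.pi / 2 - α) + r * (Real.pi / 2)) ?_ ⟨0, 0, 0, by simp⟩
      fun i _ => hangle _ _
    rintro _ _ ⟨p, q, r, rfl⟩ ⟨p', q', r', rfl⟩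
    exact ⟨p + p', q + q', r + r', by push_cast; ring⟩
  obtain ⟨m₁, m₂, m₃, hm⟩ := hcorner
  rw [hsum] at hm
  rcases angle_cases hα0 hα1 hm.symm with h | h | ⟨a, n, hn, h⟩
  · exact ⟨α, by simp [h], hαi⟩
  · exact ⟨α, by simp [h], hαi⟩
  exfalso
  obtain ⟨u, hu, hu8, htan⟩ := exists_multiplier hn
  obtain ⟨K, φ, w, v, hw, hv, hneg⟩ := exists_conjugation (by omega) hu hu8 htan
  rw [← h] at hv
  have hv0 : 0 < (v : ℝ) := by
    rw [hv]
    exact Real.tan_pos_of_pos_of_lt_pi_div_two hα0 (by linarith [Real.pi_pos])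
  have hrot : ∀ (i : ι) (l : Fin 3),
      det₃ ((t i).points l) ((t i).points (l + 1)) ((t i).points (l + 2)) ≠ 0 ∧
      openTriangle ((t i).points l) ((t i).points (l + 1)) ((t i).points (l + 2)) =
        openTriangle ((t i).points 0) ((t i).points 1) ((t i).points 2) ∧
      ∀ z, OffLines ((t i).points l) ((t i).points (l + 1)) ((t i).points (l + 2)) z ↔
        OffLines ((t i).points 0) ((t i).points 1) ((t i).points 2) z := by
    intro i l
    have hD := det₃_points_ne_zero (t i)
    fin_cases l
    · exact ⟨hD, rfl, fun _ => Iff.rfl⟩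
    · exact ⟨by rw [← det₃_rotate] at hD; exact hD, openTriangle_rotate _ _ _,
        fun _ => offLines_rotate⟩
    · exact ⟨by rw [← det₃_rotate, ← det₃_rotate] at hD; exact hD,
        (openTriangle_rotate _ _ _).trans (openTriangle_rotate _ _ _),
        fun _ => offLines_rotate.trans offLines_rotate⟩
  have hτ : ∀ i, ∃ τ : K, τ ≠ 0 ∧
      ((t i).points (j i + 2)).1 = ((t i).points (j i)).1 -
        τ * (((t i).points (j i + 1)).2 - ((t i).points (j i)).2) ∧
      ((t i).points (j i + 2)).2 = ((t i).points (j i)).2 +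
        τ * (((t i).points (j i + 1)).1 - ((t i).points (j i)).1) ∧
      SignType.sign (τ : ℝ) * φ τ * φ w ≤ 0 := by
    intro i
    have hc0 : cosAngle ((t i).points (j i)) ((t i).points (j i + 1))
        ((t i).points (j i + 2)) = 0 := by
      rw [← hcos, hj, Real.cos_pi_div_two]
    have hc1 := hcos i (j i + 1)
    rw [add_assoc, add_assoc, show (1 : Fin 3) + 1 = 2 from rfl, show (1 : Fin 3) + 2 = 0 from rfl,
      add_zero] at hc1
    obtain ⟨τ, e1, e2, e3⟩ := exists_leg_ratio (hrot i (j i)).1 (hnn i _) (hle i _) hc0 hc1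
    -- the ratio is the tangent of an acute angle of the tile or the inverse of that tangent
    obtain ⟨y, hy0, hy, hyφ⟩ : ∃ y : K, 0 < (y : ℝ) ∧ |τ| = y ∧ φ y * φ w ≤ 0 := by
      rcases (hang i).2.2 with ⟨h, -⟩ | ⟨h, -⟩
      · exact ⟨v, hv0, by rw [e3, h, hv], hneg.le⟩
      · refine ⟨v⁻¹, ?_, ?_, ?_⟩
        · rw [show ((v⁻¹ : K) : ℝ) = (v : ℝ)⁻¹ from rfl]
          exact inv_pos.2 hv0
        · rw [e3, h, Real.tan_pi_div_two_sub, ← hv]; rfl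
        · rw [map_inv₀]
          have : (φ v)⁻¹ * φ w = (φ v * φ w) * (φ v)⁻¹ ^ 2 := by
            have : φ v ≠ 0 := by rintro h; rw [h, zero_mul] at hneg; exact hneg.false
            field_simp
          rw [this]
          exact mul_nonpos_of_nonpos_of_nonneg hneg.le (sq_nonneg _)
    have hyne : y ≠ 0 := by rintro rfl; exact hy0.false
    rcases abs_choice τ with hs | hs
    · have : τ = y := by rw [← hy, hs]
      refine ⟨y, hyne, by rw [← this]; exact e1, by rw [← this]; exact e2, ?_⟩
      rw [sign_pos hy0]
      simpa using hyφ
    · have : τ = ((-y : K) : ℝ) := by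
        rw [show ((-y : K) : ℝ) = -(y : ℝ) from rfl, ← hy, hs, neg_neg]
      refine ⟨-y, neg_ne_zero.2 hyne, by rw [← this]; exact e1, by rw [← this]; exact e2, ?_⟩
      rw [show ((-y : K) : ℝ) = -(y : ℝ) from rfl, sign_neg (by linarith), map_neg]
      simpa using hyφ
  choose τ hτ0 hτ1 hτ2 hτ3 using hτ
  have hoff : ∀ i, Generic (OffLines ((t i).points 0) ((t i).points 1) ((t i).points 2)) :=
    fun i => generic_offLines (det₃_points_ne_zero _)
  have hoff' : ∀ k, Generic (OffLines 0 (octVertex k) (octVertex (k + 1))) := fun k =>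
    generic_offLines (by rw [det₃_octVertex]; positivity)
  refine not_tiled_of_conjugate K φ w hw (fun i => (t i).points (j i))
    (fun i => (t i).points (j i + 1)) (fun i => (t i).points (j i + 2))
    (fun i => (t i).independent.injective.ne (by simp)) τ hτ0 hτ1 hτ2 hτ3 ?_ ?_ ?_
  · refine ((generic_forall hoff).and (generic_forall hoff')).mono ?_
    rintro z ⟨h1, h2⟩
    simp only [(hrot _ _).2.1]
    rw [sum_tiles_eq hcov hdis h1, sum_central_eq h2]
  · intro i
    refine Generic.and ((generic_fst_ne _).and ((generic_fst_ne _).and (generic_fst_ne _))) ?_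
    exact (hoff i).mono fun z hz => ((hrot i (j i)).2.2 z).2 hz
  · intro k
    exact Generic.and ((generic_fst_ne _).and ((generic_fst_ne _).and (generic_fst_ne _))) (hoff' k)
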